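/- Let $(M,g)$ be a smooth 4-dimensional spacetime of signature $(-,+,+,+)$ with Ricci tensor $Ric$, scalar curvature $r$, Weyl tensor $W$ and (local) volume element $\eta$, and let $2Q = Ric - \frac{r}{6} g$. We write $(\cdot,\cdot)$ for $g$, use the same symbol for tensors obtained by raising or lowering indices, set $(v\wedge w)_{\alpha\beta}=v_\alpha w_\beta-w_\alpha v_\beta$, and for (real or complex) 2-forms set $(*F)_{\alpha\beta}=\frac12\eta_{\alpha\beta\lambda\mu}F^{\lambda\mu}$ and $(F,H)=\frac14(g_{\alpha\mu}g_{\beta\nu}-g_{\alpha\nu}g_{\beta\mu})F^{\alpha\beta}H^{\mu\nu}$. Suppose that $W$ is everywhere of Petrov–Bel type N: $W\neq0$ and $\mathcal W^2=0$, where $\mathcal W=\frac12(W-\mathrm i*W)$ and $(\mathcal W^2)_{\alpha\beta\mu\nu}=\frac12\mathcal W_{\alpha\beta\lambda\rho}\mathcal W^{\lambda\rho}{}_{\mu\nu}$. Then, locally, there are a smooth 2-form $L$ and a smooth null vector $\ell$ (the fundamental 2-form and the fundamental vector), unique up to sign, with $W=L\otimes L-*L\otimes *L$ and $L=\ell\wedge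 e_2$ for some unit spacelike vector $e_2$ orthogonal to $\ell$. Put $\mathcal L=\frac1{\sqrt2}(L-\mathrm i*L)$ and, with an arbitrary timelike vector field $x$, define $$a=-\frac{(\nabla L\cdot\ell)(x)}{(\ell,x)},\quad a^*=\frac{(\nabla{*L}\cdot\ell)(x)}{(\ell,x)},\quad \alpha=\frac{(a,x)}{(\ell,x)},\quad \alpha^*=\frac{(a^*,x)}{(\ell,x)},$$ $$B_{\alpha\beta}=\nabla_\alpha\ell_\beta+\nabla_\beta\ell_\alpha,\quad b=\frac{1}{(\ell,x)}\Big[B(x)-\frac{B(x,x)}{2(\ell,x)}\ell\Big],\quad C_{\alpha\beta\gamma}=\nabla_{(\alpha}{*L}_{\beta}{}^{\mu}L_{\gamma)\mu},$$ $$c=\frac{3(\ell,x)\,C(x,x)-2\,C(x,x,x)\,\ell}{(\ell,x)^3},\quad f=d\alpha-\alpha^*c,\quad f^*=d\alpha^*+\alpha c,$$ where $[(\nabla F\cdot\ell)(x)]_\mu=\nabla_\mu F_{\alpha\beta}\,\ell^\beta x^\alpha$. Let $$\varphi_1=(\nabla_\ell\mathcal L,\nabla_\ell\mathcal L),\quad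 \varphi_2=|(\nabla_a\mathcal L,\nabla_a\mathcal L)|+|(\nabla_{a^*}\mathcal L,\nabla_{a^*}\mathcal L)|,\quad \varphi_3=(d\ell,d\ell),$$ $$\varphi_4=(\ell\wedge c,\ell\wedge c),\quad \varphi_5=(db,db),\quad \varphi_6=*(\ell\wedge f\wedge f^*).$$ The family $\widehat{\mathrm C6}$ consists of the type N spacetimes with $\varphi_1=\dots=\varphi_6=0$ (a condition that depends neither on the signs of $L$, $\ell$ and $\eta$ nor on $x$). Proposition. In the family $\widehat{\mathrm C6}$, at every point the fundamental vector $\ell$ is an eigenvector of $Q$, $Q(\ell)=\lambda\ell$, and $\lambda$ is at least a double eigenvalue of $Q$, that is, a root of multiplicity at least two of the characteristic polynomial of the endomorphism $Q^\alpha{}_\beta$. Equivalently, the corresponding eigenvalue $2\lambda+\frac r6$ of the Ricci tensor is at least double. -/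

import Mathlib

open scoped Manifold ContDiff

noncomputable section

namespace TypeN

/-! ### Tensor calculus in a coordinate domain

Tensor fields on (an open subset of) the coordinate space are given by their components.  Unless
said otherwise, all indices are covariant; `g` denotes the matrix of components of the metric. -/

/-- The coordinate space. -/
abbrev Pt := EuclideanSpace ℝ (Fin 4)

/-- Components of the metric. -/
abbrev Metric := Pt → Matrix (Fin 4) (Fin 4) ℝ

/-- Covectors, 2-tensors, 3-tensors and 4-tensors at one point, by components in a ring `K`. -/
abbrev T1 (K : Type) := Fin 4 → K
abbrev T2 (K : Type) := Fin 4 → Fin 4 → K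
abbrev T3 (K : Type) := Fin 4 → Fin 4 → Fin 4 → K
abbrev T4 (K : Type) := Fin 4 → Fin 4 → Fin 4 → Fin 4 → K

/-- The partial derivative `∂_i u`. -/
def pd (i : Fin 4) (u : Pt → ℝ) (x : Pt) : ℝ :=
  fderiv ℝ u x (EuclideanSpace.single i 1)

/-- The components `g^{ij}` of the inverse metric. -/
def ginv (g : Metric) (x : Pt) : Matrix (Fin 4) (Fin 4) ℝ := (g x)⁻¹

/-- The Christoffel symbol `Γ^k_{ij}`. -/
def christoffel (g : Metric) (k i j : Fin 4) (x : Pt) : ℝ :=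
  (1 / 2) * ∑ m, ginv g x k m *
    (pd i (fun y => g y j m) x + pd j (fun y => g y i m) x - pd m (fun y => g y i j) x)

/-- The curvature tensor
`R^a_{bcd} = ∂_c Γ^a_{db} - ∂_d Γ^a_{cb} + Γ^a_{ce} Γ^e_{db} - Γ^a_{de} Γ^e_{cb}`. -/
def riemannUp (g : Metric) (a b c d : Fin 4) (x : Pt) : ℝ :=
  pd c (christoffel g a d b) x - pd d (christoffel g a c b) x
    + ∑ e, (christoffel g a c e x * christoffel g e d b x
        - christoffel g a d e x * christoffel g e c b x)

/-- The curvature tensor `R_{abcd}`. -/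
def riemann (g : Metric) (x : Pt) : T4 ℝ := fun a b c d =>
  ∑ e, g x a e * riemannUp g e b c d x

/-- The Ricci tensor `Ric_{bd} = R^a_{bad}`. -/
def ricci (g : Metric) (x : Pt) : T2 ℝ := fun b d => ∑ a, riemannUp g a b a d x

/-- The trace `r` of the Ricci tensor. -/
def scalarCurv (g : Metric) (x : Pt) : ℝ := ∑ b, ∑ d, ginv g x b d * ricci g x b d

/-- The tensor `Q`, given by `2 Q = Ric - (r / 6) g`. -/
def tensorQ (g : Metric) (x : Pt) : T2 ℝ := fun b d =>
  (1 / 2) * (ricci g x b d - scalarCurv g x / 6 * g x b d)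

/-- The Weyl tensor. -/
def weyl (g : Metric) (x : Pt) : T4 ℝ := fun a b c d =>
  riemann g x a b c d
    - (g x a c * tensorQ g x b d - g x a d * tensorQ g x b c
      + g x b d * tensorQ g x a c - g x b c * tensorQ g x a d)

/-- The endomorphism `A^a_b = g^{ac} A_{cb}` of a 2-tensor `A` at the point `x`. -/
def mixed (g : Metric) (x : Pt) (A : T2 ℝ) : Matrix (Fin 4) (Fin 4) ℝ :=
  Matrix.of fun a b => ∑ c, ginv g x a c * A c b

/-- The contravariant components `u^a = g^{ab} u_b` of a covector. -/
def raise (g : Metric) (x : Pt) (u : T1 ℝ) : T1 ℝ := fun a => ∑ b, ginv g x a b * u b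

/-- The scalar product `(u, v) = g^{ab} u_a v_b` of two covectors. -/
def ip (g : Metric) (x : Pt) (u v : T1 ℝ) : ℝ := ∑ a, ∑ b, ginv g x a b * u a * v b

/-- The pairing `u_a t^a` of a covector `u` and a vector `t`, that is, `(u, t)`. -/
def pair (u t : T1 ℝ) : ℝ := ∑ a, u a * t a

/-- The exterior product `(v ∧ w)_{ab} = v_a w_b - w_a v_b` of two covectors. -/
def wedge (v w : T1 ℝ) : T2 ℝ := fun a b => v a * w b - w a * v b

/-- The permutation symbol. -/
def eps (a b c d : Fin 4) : ℝ :=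
  Matrix.det (Matrix.of fun r s : Fin 4 => if s = ![a, b, c, d] r then (1 : ℝ) else 0)

/-- The metric volume element `η_{abcd}` for the orientation of the coordinates.  (For the other
orientation the Hodge dual `*L`, and with it `a*`, `α*`, `c` and `f*` below, change sign; the
vanishing of the invariants `φ₁, …, φ₆` is not affected.) -/
def vol (g : Metric) (x : Pt) : T4 ℝ := fun a b c d =>
  Real.sqrt |(g x).det| * eps a b c d

/-- The contravariant components `F^{ab}` of a (real or complex) 2-tensor. -/
def raise2 {K : Type} [CommRing K] [Algebra ℝ K] (g : Metric) (x : Pt) (F : T2 K) : T2 K :=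
  fun a b => ∑ c, ∑ d, algebraMap ℝ K (ginv g x a c * ginv g x b d) * F c d

/-- The Hodge dual `(*F)_{ab} = (1/2) η_{abcd} F^{cd}`. -/
def star {K : Type} [CommRing K] [Algebra ℝ K] (g : Metric) (x : Pt) (F : T2 K) : T2 K :=
  fun a b => ∑ c, ∑ d, algebraMap ℝ K (1 / 2 * vol g x a b c d) * raise2 g x F c d

/-- The metric `(F, H) = (1/4) G_{abcd} F^{ab} H^{cd}` on (real or complex) 2-forms, where
`G_{abcd} = g_{ac} g_{bd} - g_{ad} g_{bc}`. -/
def ip2 {K : Type} [CommRing K] [Algebra ℝ K] (g : Metric) (x : Pt) (F H : T2 K) : K :=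
  ∑ a, ∑ b, ∑ c, ∑ d,
    algebraMap ℝ K (1 / 4 * (g x a c * g x b d - g x a d * g x b c))
      * raise2 g x F a b * raise2 g x H c d

/-- The covariant derivative `∇_i u_a` of a covector field. -/
def nabla1 (g : Metric) (u : Pt → T1 ℝ) (x : Pt) : T2 ℝ := fun i a =>
  pd i (fun y => u y a) x - ∑ k, christoffel g k i a x * u x k

/-- The covariant derivative `∇_i F_{ab}` of a field of 2-tensors. -/
def nabla2 (g : Metric) (F : Pt → T2 ℝ) (x : Pt) : T3 ℝ := fun i a b =>
  pd i (fun y => F y a b) x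
    - ∑ k, (christoffel g k i a x * F x k b + christoffel g k i b x * F x a k)

/-- The covariant derivative of a field of complex 2-tensors. -/
def nabla2C (g : Metric) (F : Pt → T2 ℂ) (x : Pt) : T3 ℂ := fun i a b =>
  (nabla2 g (fun y a b => (F y a b).re) x i a b : ℂ)
    + Complex.I * (nabla2 g (fun y a b => (F y a b).im) x i a b : ℂ)

/-- The differential of a function. -/
def dFun (u : Pt → ℝ) (x : Pt) : T1 ℝ := fun i => pd i u x

/-- The exterior derivative of a 1-form. -/
def dForm (u : Pt → T1 ℝ) (x : Pt) : T2 ℝ := fun i j =>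
  pd i (fun y => u y j) x - pd j (fun y => u y i) x

/-! ### Type N Weyl tensors and their fundamental elements -/

/-- The self-dual Weyl tensor `𝒲 = (1/2) (W - i *W)`. -/
def selfDualWeyl (g : Metric) (x : Pt) : T4 ℂ := fun a b c d =>
  (1 / 2) * ((weyl g x a b c d : ℂ)
    - Complex.I * (star g x (fun a' b' => weyl g x a' b' c d) a b : ℂ))

/-- The Weyl tensor is of Petrov-Bel type N at `x`: it is not zero and `𝒲² = 0`, where
`(𝒲²)_{abmn} = (1/2) 𝒲_{abpq} 𝒲^{pq}_{mn}`. -/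
def IsTypeNAt (g : Metric) (x : Pt) : Prop :=
  weyl g x ≠ 0 ∧
  ∀ a b m n, (1 / 2 : ℂ) * ∑ p, ∑ q, selfDualWeyl g x a b p q
    * raise2 g x (fun p' q' => selfDualWeyl g x p' q' m n) p q = 0

/-- `l` is the fundamental vector (in covariant components) and `L` the fundamental 2-form of the
Weyl tensor at `x`: `W = L ⊗ L - *L ⊗ *L`, and `L = l ∧ e₂` with `l` null and `e₂` spacelike,
unitary and orthogonal to `l`.  Both `l` and `L` are determined by this up to sign. -/
def IsFundamentalAt (g : Metric) (x : Pt) (l : T1 ℝ) (L : T2 ℝ) : Prop :=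
  (∀ a b c d, weyl g x a b c d = L a b * L c d - star g x L a b * star g x L c d) ∧
  ip g x l l = 0 ∧
  ∃ e : T1 ℝ, ip g x e e = 1 ∧ ip g x l e = 0 ∧ L = wedge l e

/-! ### The Weyl concomitants

Below, `l` and `L` are the fields of fundamental vectors and 2-forms, and `t` is a field of
timelike vectors (in contravariant components). -/

section Concomitants

variable (g : Metric) (l : Pt → T1 ℝ) (L : Pt → T2 ℝ) (t : Pt → T1 ℝ)

/-- The field `*L`. -/
def starL (x : Pt) : T2 ℝ := star g x (L x)

/-- The fundamental bivector `𝓛 = (L - i *L) / √2`. -/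
def bivector (x : Pt) : T2 ℂ := fun a b =>
  (1 / Real.sqrt 2 : ℂ) * ((L x a b : ℂ) - Complex.I * (starL g L x a b : ℂ))

/-- The derivative `∇_u 𝓛` in the direction of `u` (given in covariant components). -/
def nablaBivector (x : Pt) (u : T1 ℝ) : T2 ℂ := fun a b =>
  ∑ i, (raise g x u i : ℂ) * nabla2C g (bivector g L) x i a b

/-- `𝓕₁ = ∇_l 𝓛`. -/
def F1 (x : Pt) : T2 ℂ := nablaBivector g L x (l x)

/-- `φ₁ = (𝓕₁, 𝓕₁)`. -/
def phi1 (x : Pt) : ℂ := ip2 g x (F1 g l L x) (F1 g l L x)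

/-- The invariant vector `a = -(∇L · l)(t) / (l, t)`. -/
def vecA (x : Pt) : T1 ℝ := fun i =>
  -(1 / pair (l x) (t x)) * ∑ p, ∑ q, nabla2 g L x i p q * raise g x (l x) q * t x p

/-- The invariant vector `a* = (∇*L · l)(t) / (l, t)`. -/
def vecAstar (x : Pt) : T1 ℝ := fun i =>
  (1 / pair (l x) (t x)) * ∑ p, ∑ q, nabla2 g (starL g L) x i p q * raise g x (l x) q * t x p

/-- `𝓕₂ = ∇_a 𝓛`. -/
def F2 (x : Pt) : T2 ℂ := nablaBivector g L x (vecA g l L t x)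

/-- `𝓕₂* = ∇_{a*} 𝓛`. -/
def F2star (x : Pt) : T2 ℂ := nablaBivector g L x (vecAstar g l L t x)

/-- `φ₂ = |(𝓕₂, 𝓕₂)| + |(𝓕₂*, 𝓕₂*)|`. -/
def phi2 (x : Pt) : ℝ :=
  ‖ip2 g x (F2 g l L t x) (F2 g l L t x)‖ + ‖ip2 g x (F2star g l L t x) (F2star g l L t x)‖

/-- The scalar `α = (a, t) / (l, t)`. -/
def alpha (x : Pt) : ℝ := pair (vecA g l L t x) (t x) / pair (l x) (t x)

/-- The scalar `α* = (a*, t) / (l, t)`. -/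
def alphaStar (x : Pt) : ℝ := pair (vecAstar g l L t x) (t x) / pair (l x) (t x)

/-- The symmetric tensor `B = ∇l + ᵗ∇l`. -/
def tensorB (x : Pt) : T2 ℝ := fun i j => nabla1 g l x i j + nabla1 g l x j i

/-- The invariant vector `b = [B(t) - B(t, t) / (2 (l, t)) l] / (l, t)`. -/
def vecB (x : Pt) : T1 ℝ := fun i =>
  (1 / pair (l x) (t x)) * ((∑ j, tensorB g l x i j * t x j)
    - (∑ p, ∑ q, tensorB g l x p q * t x p * t x q) / (2 * pair (l x) (t x)) * l x i)

/-- `F₃ = dl` and `φ₃ = (F₃, F₃)`. -/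
def phi3 (x : Pt) : ℝ := ip2 g x (dForm l x) (dForm l x)

/-- The 3-tensor `∇_i *L_j^m L_{km}`. -/
def tensorC0 (x : Pt) : T3 ℝ := fun i j k =>
  ∑ m, ∑ n, nabla2 g (starL g L) x i j n * ginv g x n m * L x k m

/-- The 3-tensor `C`, the totally symmetric part of `∇_i *L_j^m L_{km}`. -/
def tensorC (x : Pt) : T3 ℝ := fun i j k =>
  (1 / 6) * (tensorC0 g L x i j k + tensorC0 g L x i k j + tensorC0 g L x j i k
    + tensorC0 g L x j k i + tensorC0 g L x k i j + tensorC0 g L x k j i)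

/-- The invariant vector `c = [3 (l, t) C(t, t) - 2 C(t, t, t) l] / (l, t)³`. -/
def vecC (x : Pt) : T1 ℝ := fun i =>
  (1 / pair (l x) (t x) ^ 3) *
    (3 * pair (l x) (t x) * (∑ j, ∑ k, tensorC g L x i j k * t x j * t x k)
      - 2 * (∑ p, ∑ j, ∑ k, tensorC g L x p j k * t x p * t x j * t x k) * l x i)

/-- `F₄ = l ∧ c` and `φ₄ = (F₄, F₄)`. -/
def phi4 (x : Pt) : ℝ :=
  ip2 g x (wedge (l x) (vecC g l L t x)) (wedge (l x) (vecC g l L t x))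

/-- `F₅ = db` and `φ₅ = (F₅, F₅)`. -/
def phi5 (x : Pt) : ℝ := ip2 g x (dForm (vecB g l t) x) (dForm (vecB g l t) x)

/-- The vector `f = dα - α* c`. -/
def vecF (x : Pt) : T1 ℝ := fun i =>
  dFun (alpha g l L t) x i - alphaStar g l L t x * vecC g l L t x i

/-- The vector `f* = dα* + α c`. -/
def vecFstar (x : Pt) : T1 ℝ := fun i =>
  dFun (alphaStar g l L t) x i + alpha g l L t x * vecC g l L t x i

/-- The vector `φ₆ = *(l ∧ f ∧ f*)`, that is, `(φ₆)_a = η_{abcd} l^b f^c (f*)^d`. -/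
def phi6 (x : Pt) : T1 ℝ := fun a =>
  ∑ b, ∑ c, ∑ d, vol g x a b c d * raise g x (l x) b
    * raise g x (vecF g l L t x) c * raise g x (vecFstar g l L t x) d

end Concomitants

/-- The metric with components `g` on the open coordinate domain `D` is of type N and
`φ₁ = ⋯ = φ₆ = 0`.  The invariants are computed, near each point, from smooth local fields of
fundamental vectors and 2-forms and a smooth local field of timelike vectors; the vanishing does
not depend on the choice of these fields. -/
def InFamilyC6On (g : Metric) (D : Set Pt) : Prop :=
  (∀ x ∈ D, IsTypeNAt g x) ∧
  ∀ x₀ ∈ D, ∃ (U : Set Pt) (l : Pt → T1 ℝ) (L : Pt → T2 ℝ) (t : Pt → T1 ℝ),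
    IsOpen U ∧ x₀ ∈ U ∧ U ⊆ D ∧
    (∀ a, ContDiffOn ℝ ∞ (fun x => l x a) U) ∧
    (∀ a b, ContDiffOn ℝ ∞ (fun x => L x a b) U) ∧
    (∀ a, ContDiffOn ℝ ∞ (fun x => t x a) U) ∧
    ∀ x ∈ U,
      IsFundamentalAt g x (l x) (L x) ∧
      (∑ a, ∑ b, g x a b * t x a * t x b < 0) ∧
      phi1 g l L x = 0 ∧ phi2 g l L t x = 0 ∧ phi3 g l x = 0 ∧
      phi4 g l L t x = 0 ∧ phi5 g l t x = 0 ∧ phi6 g l L t x = 0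

/-! ### Spacetimes -/

section Spacetime

variable (M : Type*) [TopologicalSpace M] [ChartedSpace Pt M]

/-- The components, in the coordinates given by a chart `e`, of a field of bilinear forms. -/
def components {M : Type*} [TopologicalSpace M] [ChartedSpace Pt M]
    (val : ∀ p : M, LinearMap.BilinForm ℝ (TangentSpace (𝓡 4) p))
    (e : OpenPartialHomeomorph M Pt) : Metric := fun x =>
  Matrix.of fun i j =>
    val (e.symm x)
      (mfderiv (𝓡 4) (𝓡 4) e.symm x (EuclideanSpace.single i (1 : ℝ) : Pt))
      (mfderiv (𝓡 4) (𝓡 4) e.symm x (EuclideanSpace.single j (1 : ℝ) : Pt))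

/-- A smooth metric of signature `(-,+,+,+)` on a 4-dimensional manifold. -/
structure LorentzMetric where
  /-- The metric at each point. -/
  val : ∀ p : M, LinearMap.BilinForm ℝ (TangentSpace (𝓡 4) p)
  symm : ∀ p u v, val p u v = val p v u
  signature : ∀ p, ∃ b : Module.Basis (Fin 4) ℝ (TangentSpace (𝓡 4) p),
    ∀ i j, val p (b i) (b j) = if i = j then (if i = 0 then -1 else 1) else 0
  smooth : ∀ e ∈ atlas Pt M, ∀ i j,
    ContDiffOn ℝ ∞ (fun x => components val e x i j) e.target

variable {M}

/-- The components of the metric in a chart. -/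
def LorentzMetric.inChart (g : LorentzMetric M) (e : OpenPartialHomeomorph M Pt) : Metric :=
  components g.val e

/-- The family `Ĉ6`: type N spacetimes with `φ₁ = ⋯ = φ₆ = 0`. -/
def LorentzMetric.InFamilyC6 (g : LorentzMetric M) : Prop :=
  ∀ e ∈ atlas Pt M, InFamilyC6On (g.inChart e) e.target

end Spacetime

end TypeN

end

/-!
The vanishing of `φ₁` and `φ₂` alone forces the conclusion.

Choose locally smooth covector fields `e`, `f` with `L = l ∧ e` and `*L = l ∧ f`, part of a null
frame `l, k, e, f`. For a direction `u`, the square of `∇_u 𝓛` is `((∇_u l, f) + i (∇_u l, e))²`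
(`IsAdaptedOn.ip2_nablaBivector`), while the invariant vectors are `a = (∇l, e)` and
`a* = -(∇l, f)`. Thus `φ₁ = 0` says that `a` and `a*` are orthogonal to `l`, and `φ₂ = 0` that they
are null, so they are proportional to `l`. In other words `∇_u l` is proportional to `l` for
every `u` orthogonal to `l`, that is, `∇l = w ⊗ l + l ⊗ s` with smooth `w` and `s`
(`IsAdaptedOn.exists_smooth_nabla1_eq`).

By the Ricci identity, the curvature of two directions orthogonal to `l` then maps `l` to a multiple
of `l` (`IsLorentzOn.riemannUp_of_nabla1`). The Weyl tensor `L ⊗ L - *L ⊗ *L` is annihilated by `l`,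
so the curvature applied to `l` is built from `g`, `Q` and `q = Q(l)` only, and for `u, v, w`
orthogonal to `l` it gives `(w, v) (q, u) = (w, u) (q, v)`. Hence `q` is orthogonal to `l, e, f`, and
so proportional to `l` (`IsFundamentalAt.tensorQ_eigenvector`).

Finally `l` is a null vector which is both a right and a left eigenvector of the symmetric tensor
`Q`, so its eigenvalue is at least double (`IsNullFrame.two_le_rootMultiplicity`). The symmetry of
`Q` comes from the first Bianchi identity (`IsFundamentalAt.tensorQ_symm`).
-/

noncomputable section

namespace TypeN

/-! ### Null frames at a point -/

/-- The matrix `g x` is symmetric and of signature `(-,+,+,+)`. -/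
def IsLorentzAt (g : Metric) (x : Pt) : Prop :=
  (g x).IsSymm ∧ ∃ E : Matrix (Fin 4) (Fin 4) ℝ,
    E.transpose * g x * E = Matrix.diagonal ![-1, 1, 1, 1]

/-- The covectors `l, k, e, f` form a null frame: `l, k` are null with `(l, k) = -1`, and `e, f`
are unit, orthogonal to each other and to `l, k`. -/
structure IsNullFrame (g : Metric) (x : Pt) (l k e f : T1 ℝ) : Prop where
  ll : ip g x l l = 0
  lk : ip g x l k = -1
  le : ip g x l e = 0
  lf : ip g x l f = 0
  kk : ip g x k k = 0
  ke : ip g x k e = 0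
  kf : ip g x k f = 0
  ee : ip g x e e = 1
  ef : ip g x e f = 0
  ff : ip g x f f = 1

section Pointwise

variable {g : Metric} {x : Pt}

lemma minkowski_mul_self :
    (Matrix.diagonal ![-1, 1, 1, 1] : Matrix (Fin 4) (Fin 4) ℝ) * Matrix.diagonal ![-1, 1, 1, 1]
      = 1 := by
  rw [Matrix.diagonal_mul_diagonal, ← Matrix.diagonal_one]
  congr 1
  funext i
  fin_cases i <;> simp

lemma IsLorentzAt.det_neg (h : IsLorentzAt g x) : (g x).det < 0 := by
  obtain ⟨-, E, hE⟩ := h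
  have h1 := congrArg Matrix.det hE
  rw [Matrix.det_mul, Matrix.det_mul, Matrix.det_transpose, Matrix.det_diagonal] at h1
  simp [Fin.prod_univ_four] at h1
  nlinarith [sq_nonneg E.det]

lemma IsLorentzAt.isUnit_det (h : IsLorentzAt g x) : IsUnit (g x).det :=
  isUnit_iff_ne_zero.mpr h.det_neg.ne

lemma IsLorentzAt.g_symm (h : IsLorentzAt g x) (a b : Fin 4) : g x a b = g x b a :=
  h.1.apply b a

lemma IsLorentzAt.ginv_isSymm (h : IsLorentzAt g x) : (ginv g x).IsSymm := by
  unfold ginv Matrix.IsSymm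
  rw [Matrix.transpose_nonsing_inv, h.1]

lemma IsLorentzAt.ginv_symm (h : IsLorentzAt g x) (a b : Fin 4) :
    ginv g x a b = ginv g x b a := h.ginv_isSymm.apply b a

lemma IsLorentzAt.sum_g_mul_ginv (h : IsLorentzAt g x) (a b : Fin 4) :
    ∑ c, g x a c * ginv g x c b = if a = b then 1 else 0 := by
  rw [← Matrix.mul_apply, ginv, Matrix.mul_nonsing_inv _ h.isUnit_det, Matrix.one_apply]

lemma IsLorentzAt.sum_ginv_mul_g (h : IsLorentzAt g x) (a b : Fin 4) :
    ∑ c, ginv g x a c * g x c b = if a = b then 1 else 0 := by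
  rw [← Matrix.mul_apply, ginv, Matrix.nonsing_inv_mul _ h.isUnit_det, Matrix.one_apply]

lemma ip_eq_pair_raise (u v : T1 ℝ) : ip g x u v = pair u (raise g x v) := by
  simp only [ip, pair, raise, Finset.mul_sum]
  exact Finset.sum_congr rfl fun a _ => Finset.sum_congr rfl fun b _ => by ring

lemma IsLorentzAt.ip_comm (h : IsLorentzAt g x) (u v : T1 ℝ) : ip g x u v = ip g x v u := by
  simp only [ip]
  rw [Finset.sum_comm]
  exact Finset.sum_congr rfl fun a _ => Finset.sum_congr rfl fun b _ => by
    rw [h.ginv_symm b a]; ring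

lemma ip_add_left (u v w : T1 ℝ) : ip g x (u + v) w = ip g x u w + ip g x v w := by
  simp only [ip, Pi.add_apply, ← Finset.sum_add_distrib]
  exact Finset.sum_congr rfl fun a _ => Finset.sum_congr rfl fun b _ => by ring

lemma ip_add_right (u v w : T1 ℝ) : ip g x u (v + w) = ip g x u v + ip g x u w := by
  simp only [ip, Pi.add_apply, ← Finset.sum_add_distrib]
  exact Finset.sum_congr rfl fun a _ => Finset.sum_congr rfl fun b _ => by ring

lemma ip_smul_left (c : ℝ) (u v : T1 ℝ) : ip g x (c • u) v = c * ip g x u v := by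
  simp only [ip, Pi.smul_apply, smul_eq_mul, Finset.mul_sum]
  exact Finset.sum_congr rfl fun a _ => Finset.sum_congr rfl fun b _ => by ring

lemma ip_smul_right (c : ℝ) (u v : T1 ℝ) : ip g x u (c • v) = c * ip g x u v := by
  simp only [ip, Pi.smul_apply, smul_eq_mul, Finset.mul_sum]
  exact Finset.sum_congr rfl fun a _ => Finset.sum_congr rfl fun b _ => by ring

lemma IsLorentzAt.sum_g_mul_raise (h : IsLorentzAt g x) (u : T1 ℝ) (a : Fin 4) :
    ∑ b, g x a b * raise g x u b = u a := by
  simp only [raise, Finset.mul_sum]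
  rw [Finset.sum_comm]
  simp only [← mul_assoc, ← Finset.sum_mul, h.sum_g_mul_ginv]
  simp

lemma IsLorentzAt.sum_g_raise_raise (h : IsLorentzAt g x) (u v : T1 ℝ) :
    ∑ a, ∑ b, g x a b * raise g x u a * raise g x v b = ip g x u v := by
  rw [h.ip_comm, ip_eq_pair_raise, pair]
  refine Finset.sum_congr rfl fun a _ => ?_
  rw [← h.sum_g_mul_raise v a, Finset.sum_mul]
  exact Finset.sum_congr rfl fun b _ => by ring

/-- In the coordinates of a Lorentz frame `E` the scalar product of covectors is that of Minkowski
space. -/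
lemma ip_eq_minkowski {E : Matrix (Fin 4) (Fin 4) ℝ}
    (hE : E.transpose * g x * E = Matrix.diagonal ![-1, 1, 1, 1]) (u v : T1 ℝ) :
    ip g x u v = -(Matrix.vecMul u E 0 * Matrix.vecMul v E 0)
      + Matrix.vecMul u E 1 * Matrix.vecMul v E 1 + Matrix.vecMul u E 2 * Matrix.vecMul v E 2
      + Matrix.vecMul u E 3 * Matrix.vecMul v E 3 := by
  have h1 : E.transpose * (g x * E * Matrix.diagonal ![-1, 1, 1, 1]) = 1 := by
    rw [← Matrix.mul_assoc, ← Matrix.mul_assoc, hE, minkowski_mul_self]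
  have h2 : ginv g x = E * Matrix.diagonal ![-1, 1, 1, 1] * E.transpose := by
    refine Matrix.inv_eq_right_inv ?_
    rw [← Matrix.mul_assoc, ← Matrix.mul_assoc]
    exact mul_eq_one_comm.mp h1
  have h3 : ip g x u v = dotProduct u (Matrix.mulVec (ginv g x) v) := by
    simp only [ip, dotProduct, Matrix.mulVec, Finset.mul_sum]
    exact Finset.sum_congr rfl fun a _ => Finset.sum_congr rfl fun b _ => by ring
  rw [h3, h2, ← Matrix.mulVec_mulVec, Matrix.mulVec_transpose, ← Matrix.mulVec_mulVec,
    Matrix.dotProduct_mulVec]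
  simp [dotProduct, Matrix.mulVec_diagonal, Fin.sum_univ_four]

/-- A null vector and a unit vector orthogonal to it can be completed to a null frame. -/
lemma IsLorentzAt.exists_nullFrame (h : IsLorentzAt g x) {l e : T1 ℝ} (hl : l ≠ 0)
    (hll : ip g x l l = 0) (hle : ip g x l e = 0) (hee : ip g x e e = 1) :
    ∃ k f, IsNullFrame g x l k e f := by
  obtain ⟨-, E, hE⟩ := h
  have hEu : IsUnit E.det := by
    have h1 := congrArg Matrix.det hE
    rw [Matrix.det_mul, Matrix.det_mul, Matrix.det_transpose, Matrix.det_diagonal] at h1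
    refine isUnit_iff_ne_zero.mpr fun h0 => ?_
    simp [Fin.prod_univ_four, h0] at h1
  have hback : ∀ v : T1 ℝ, Matrix.vecMul (Matrix.vecMul v E⁻¹) E = v := fun v => by
    rw [Matrix.vecMul_vecMul, Matrix.nonsing_inv_mul _ hEu, Matrix.vecMul_one]
  have hl' : Matrix.vecMul l E ≠ 0 := fun h0 => hl <| by
    have := congrArg (fun v => Matrix.vecMul v E⁻¹) h0
    simpa [Matrix.vecMul_vecMul, Matrix.mul_nonsing_inv _ hEu] using this
  have hip := ip_eq_minkowski hE
  rw [hip] at hll hle hee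
  set L := Matrix.vecMul l E with hLdef
  set F := Matrix.vecMul e E with hFdef
  have hL0 : L 0 ≠ 0 := fun h0 => hl' <| by
    rw [h0] at hll
    funext i
    fin_cases i
    · exact h0
    all_goals
      refine pow_eq_zero_iff (n := 2) two_ne_zero |>.mp ?_
      simp
      nlinarith [sq_nonneg (L 1), sq_nonneg (L 2), sq_nonneg (L 3)]
  -- `m` makes `e - m l` purely spatial in the Lorentz frame.
  obtain ⟨m, hm⟩ : ∃ m, F 0 = m * L 0 := ⟨F 0 / L 0, by field_simp⟩
  obtain ⟨c, hc⟩ : ∃ c, c * L 0 = 1 := ⟨(L 0)⁻¹, by field_simp⟩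
  set a1 := F 1 - m * L 1 with ha1
  set a2 := F 2 - m * L 2 with ha2
  set a3 := F 3 - m * L 3 with ha3
  have hs : L 1 * a1 + L 2 * a2 + L 3 * a3 = 0 := by
    rw [ha1, ha2, ha3]; linear_combination hle - m * hll + L 0 * hm
  have hn : a1 ^ 2 + a2 ^ 2 + a3 ^ 2 = 1 := by
    rw [ha1, ha2, ha3]
    linear_combination hee - 2 * m * hle + m ^ 2 * hll + (F 0 - m * L 0) * hm
  have hq : L 1 ^ 2 + L 2 ^ 2 + L 3 ^ 2 = L 0 ^ 2 := by linear_combination hll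
  have e1 : F 1 = a1 + m * L 1 := by rw [ha1]; ring
  have e2 : F 2 = a2 + m * L 2 := by rw [ha2]; ring
  have e3 : F 3 = a3 + m * L 3 := by rw [ha3]; ring
  clear_value a1 a2 a3 L F
  -- In the Lorentz frame `f` is `(0, l × a) / l₀` with the spatial part `a` of `e - m l`, and `k` is
  -- the reflection of `l`, scaled, followed by the null rotation that takes `e - m l` to `e`.
  refine ⟨Matrix.vecMul ![c / 2 + m ^ 2 / 2 * L 0,
      -(c ^ 2 / 2) * L 1 + m * a1 + m ^ 2 / 2 * L 1,
      -(c ^ 2 / 2) * L 2 + m * a2 + m ^ 2 / 2 * L 2,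
      -(c ^ 2 / 2) * L 3 + m * a3 + m ^ 2 / 2 * L 3] E⁻¹,
    Matrix.vecMul ![0, c * (L 2 * a3 - L 3 * a2), c * (L 3 * a1 - L 1 * a3),
      c * (L 1 * a2 - L 2 * a1)] E⁻¹, ?_⟩
  constructor <;> rw [hip] <;> simp only [hback, ← hLdef, ← hFdef] <;>
    try simp only [Matrix.cons_val, e1, e2, e3, hm]
  · linear_combination hll
  · linear_combination (m) * hs +(m ^ 2 / 2 - c ^ 2 / 2) * hq - (1/2 + (c * L 0 + 1)/2) * hc
  · linear_combination hs + m * hq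
  · ring
  · linear_combination (m ^ 2 / 2 - c ^ 2 / 2) ^ 2 * hq + m ^ 2 * hn
      + 2 * m * (m ^ 2 / 2 - c ^ 2 / 2) * hs
      + (-(m ^ 2 / 2) * (c * L 0 + 2) + c ^ 2 / 4 * (c * L 0 + 1)) * hc
  · linear_combination (m ^ 2 / 2 - c ^ 2 / 2 + m ^ 2) * hs + m * hn
      + m * (m ^ 2 / 2 - c ^ 2 / 2) * hq - (m / 2) * (c * L 0 + 2) * hc
  · ring
  · linear_combination hn + 2 * m * hs + m ^ 2 * hq
  · ring
  · linear_combination c ^ 2 * (a1 ^ 2 + a2 ^ 2 + a3 ^ 2) * hq + c ^ 2 * L 0 ^ 2 * hn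
      + (c * L 0 + 1) * hc - c ^ 2 * (L 1 * a1 + L 2 * a2 + L 3 * a3) * hs

end Pointwise

section Frame

variable {g : Metric} {x : Pt}

lemma IsNullFrame.completeness (hg : IsLorentzAt g x) {l k e f : T1 ℝ}
    (h : IsNullFrame g x l k e f) (a b : Fin 4) :
    -(raise g x l a * k b + raise g x k a * l b) + raise g x e a * e b + raise g x f a * f b
      = if a = b then 1 else 0 := by
  have h1 : Matrix.of ![l, k, e, f] *
      (Matrix.of ![-raise g x k, -raise g x l, raise g x e, raise g x f]).transpose = 1 := by
    ext i j
    have key : ∀ u v : T1 ℝ, ∑ a, u a * raise g x v a = ip g x u v := fun u v =>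
      (ip_eq_pair_raise u v).symm
    have kl := (hg.ip_comm k l).trans h.lk
    have el := (hg.ip_comm e l).trans h.le
    have fl := (hg.ip_comm f l).trans h.lf
    have ek := (hg.ip_comm e k).trans h.ke
    have fk := (hg.ip_comm f k).trans h.kf
    have fe := (hg.ip_comm f e).trans h.ef
    rw [Matrix.mul_apply]
    fin_cases i <;> fin_cases j <;>
      simp [key, h.ll, h.lk, h.le, h.lf, h.kk, h.ke, h.kf, h.ee, h.ef, h.ff, kl, el, fl, ek, fk, fe]
  have h2 := Matrix.ext_iff.mpr (mul_eq_one_comm.mp h1) a b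
  rw [Matrix.mul_apply, Matrix.one_apply] at h2
  rw [← h2]
  simp [Fin.sum_univ_four]

/-- A covector in terms of its components in a null frame. -/
lemma IsNullFrame.expand (hg : IsLorentzAt g x) {l k e f : T1 ℝ}
    (h : IsNullFrame g x l k e f) (v : T1 ℝ) (b : Fin 4) :
    v b = -(ip g x v l * k b + ip g x v k * l b) + ip g x v e * e b + ip g x v f * f b := by
  have h1 : v b = ∑ a, v a * (if a = b then 1 else 0) := by simp
  rw [h1]
  simp only [← h.completeness hg, ip_eq_pair_raise, pair, Fin.sum_univ_four]
  ring

lemma ip_g_row (hg : IsLorentzAt g x) (a : Fin 4) (v : T1 ℝ) : ip g x (g x a) v = v a := by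
  rw [ip_eq_pair_raise, pair]
  exact hg.sum_g_mul_raise v a

lemma IsNullFrame.metric_eq (hg : IsLorentzAt g x) {l k e f : T1 ℝ}
    (h : IsNullFrame g x l k e f) (a b : Fin 4) :
    g x a b = -(l a * k b + k a * l b) + e a * e b + f a * f b := by
  have := h.expand hg (g x a) b
  simpa only [ip_g_row hg] using this

/-- A timelike vector is not orthogonal to a null vector of a null frame. -/
lemma IsNullFrame.pair_ne_zero (hg : IsLorentzAt g x) {l k e f t : T1 ℝ}
    (h : IsNullFrame g x l k e f) (ht : ∑ a, ∑ b, g x a b * t a * t b < 0) : pair l t ≠ 0 := by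
  intro h0
  have h1 : ∑ a, ∑ b, g x a b * t a * t b
      = -2 * pair l t * pair k t + pair e t ^ 2 + pair f t ^ 2 := by
    simp only [h.metric_eq hg, pair, Fin.sum_univ_four]
    ring
  rw [h1, h0] at ht
  nlinarith [sq_nonneg (pair e t), sq_nonneg (pair f t)]

/-- The scalar product of 2-forms on exterior products of covectors. -/
lemma IsLorentzAt.ip2_wedge (hg : IsLorentzAt g x) (u v u' v' : T1 ℝ) :
    ip2 g x (wedge u v) (wedge u' v')
      = ip g x u u' * ip g x v v' - ip g x u v' * ip g x v u' := by
  have hr : ∀ (u v : T1 ℝ) (a b : Fin 4), raise2 g x (wedge u v) a b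
      = raise g x u a * raise g x v b - raise g x v a * raise g x u b := by
    intro u v a b
    simp only [raise2, wedge, raise, Finset.sum_mul_sum, ← Finset.sum_sub_distrib,
      Algebra.algebraMap_self, RingHom.id_apply]
    exact Finset.sum_congr rfl fun c _ => Finset.sum_congr rfl fun d _ => by ring
  have hsum : ∀ p q : Fin 4 → Fin 4 → ℝ, ∑ a, ∑ b, ∑ c, ∑ d, p a c * q b d
      = (∑ a, ∑ c, p a c) * ∑ b, ∑ d, q b d := by
    intro p q
    rw [Finset.sum_mul_sum]
    refine Finset.sum_congr rfl fun a _ => Finset.sum_congr rfl fun b _ => ?_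
    rw [Finset.sum_mul_sum]
  have hsum' : ∀ p q : Fin 4 → Fin 4 → ℝ, ∑ a, ∑ b, ∑ c, ∑ d, p a d * q b c
      = (∑ a, ∑ c, p a c) * ∑ b, ∑ d, q b d := by
    intro p q
    rw [← hsum]
    exact Finset.sum_congr rfl fun a _ => Finset.sum_congr rfl fun b _ => Finset.sum_comm
  have hG := hg.sum_g_raise_raise
  have expand : ∀ u v u' v' : T1 ℝ, ∑ a, ∑ b, ∑ c, ∑ d, (g x a c * g x b d - g x a d * g x b c)
        * (raise g x u a * raise g x v b) * (raise g x u' c * raise g x v' d)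
      = ip g x u u' * ip g x v v' - ip g x u v' * ip g x v u' := by
    intro u v u' v'
    rw [← hG u u', ← hG v v', ← hG u v', ← hG v u', ← hsum, ← hsum']
    simp only [← Finset.sum_sub_distrib]
    refine Finset.sum_congr rfl fun a _ => Finset.sum_congr rfl fun b _ =>
      Finset.sum_congr rfl fun c _ => Finset.sum_congr rfl fun d _ => by ring
  have main : ip2 g x (wedge u v) (wedge u' v') = (1 / 4) *
      ((∑ a, ∑ b, ∑ c, ∑ d, (g x a c * g x b d - g x a d * g x b c)
        * (raise g x u a * raise g x v b) * (raise g x u' c * raise g x v' d))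
      - (∑ a, ∑ b, ∑ c, ∑ d, (g x a c * g x b d - g x a d * g x b c)
        * (raise g x v a * raise g x u b) * (raise g x u' c * raise g x v' d))
      - (∑ a, ∑ b, ∑ c, ∑ d, (g x a c * g x b d - g x a d * g x b c)
        * (raise g x u a * raise g x v b) * (raise g x v' c * raise g x u' d))
      + (∑ a, ∑ b, ∑ c, ∑ d, (g x a c * g x b d - g x a d * g x b c)
        * (raise g x v a * raise g x u b) * (raise g x v' c * raise g x u' d))) := by
    simp only [ip2, hr, ← Finset.sum_sub_distrib, ← Finset.sum_add_distrib, Finset.mul_sum,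
      Algebra.algebraMap_self, RingHom.id_apply]
    refine Finset.sum_congr rfl fun a _ => Finset.sum_congr rfl fun b _ =>
      Finset.sum_congr rfl fun c _ => Finset.sum_congr rfl fun d _ => by ring
  rw [main]
  simp only [expand]
  ring

lemma ip2_add_left {K : Type} [CommRing K] [Algebra ℝ K] (F F' H : T2 K) :
    ip2 g x (F + F') H = ip2 g x F H + ip2 g x F' H := by
  simp only [ip2, raise2, Pi.add_apply, mul_add, add_mul, Finset.sum_add_distrib]

lemma ip2_smul_left {K : Type} [CommRing K] [Algebra ℝ K] (c : K) (F H : T2 K) :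
    ip2 g x (c • F) H = c * ip2 g x F H := by
  have hr : ∀ a b, raise2 g x (c • F) a b = c * raise2 g x F a b := fun a b => by
    simp only [raise2, Pi.smul_apply, smul_eq_mul, Finset.mul_sum]
    exact Finset.sum_congr rfl fun _ _ => Finset.sum_congr rfl fun _ _ => by ring
  simp only [ip2, hr, Finset.mul_sum]
  refine Finset.sum_congr rfl fun a _ => Finset.sum_congr rfl fun b _ =>
      Finset.sum_congr rfl fun c _ => Finset.sum_congr rfl fun d _ => by ring

lemma IsLorentzAt.ip2_comm (hg : IsLorentzAt g x) {K : Type} [CommRing K] [Algebra ℝ K]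
    (F H : T2 K) : ip2 g x F H = ip2 g x H F := by
  have h1 : ip2 g x F H = ∑ c, ∑ d, ∑ a, ∑ b,
      algebraMap ℝ K (1 / 4 * (g x a c * g x b d - g x a d * g x b c))
      * raise2 g x F a b * raise2 g x H c d := by
    unfold ip2
    calc _ = ∑ a, ∑ c, ∑ b, ∑ d, algebraMap ℝ K (1 / 4 * (g x a c * g x b d - g x a d * g x b c))
            * raise2 g x F a b * raise2 g x H c d :=
          Finset.sum_congr rfl fun a _ => Finset.sum_comm
      _ = ∑ c, ∑ a, ∑ d, ∑ b, algebraMap ℝ K (1 / 4 * (g x a c * g x b d - g x a d * g x b c))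
            * raise2 g x F a b * raise2 g x H c d := by
          rw [Finset.sum_comm]
          exact Finset.sum_congr rfl fun a _ => Finset.sum_congr rfl fun a _ => Finset.sum_comm
      _ = _ := Finset.sum_congr rfl fun a _ => Finset.sum_comm
  rw [h1]
  refine Finset.sum_congr rfl fun a _ => Finset.sum_congr rfl fun b _ =>
      Finset.sum_congr rfl fun c _ => Finset.sum_congr rfl fun d _ => ?_
  rw [hg.g_symm c a, hg.g_symm d b, hg.g_symm c b, hg.g_symm d a]
  ring_nf

lemma ip2_ofReal (F H : T2 ℝ) :
    ip2 g x (fun a b => (F a b : ℂ)) (fun a b => (H a b : ℂ)) = ((ip2 g x F H : ℝ) : ℂ) := by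
  simp only [ip2, raise2, Complex.coe_algebraMap, Algebra.algebraMap_self, RingHom.id_apply]
  push_cast
  rfl

/-- The square of the complex 2-form `c (P - i S)`. -/
lemma IsLorentzAt.ip2_complex (hg : IsLorentzAt g x) (c : ℂ) (P S : T2 ℝ) :
    ip2 g x (fun a b => c * ((P a b : ℂ) - Complex.I * (S a b : ℂ)))
        (fun a b => c * ((P a b : ℂ) - Complex.I * (S a b : ℂ)))
      = c ^ 2 * (((ip2 g x P P - ip2 g x S S : ℝ) : ℂ) - 2 * Complex.I * ((ip2 g x P S : ℝ) : ℂ)) := by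
  have h1 : (fun a b => c * ((P a b : ℂ) - Complex.I * (S a b : ℂ)))
      = c • ((fun a b => (P a b : ℂ)) + (-Complex.I) • fun a b => (S a b : ℂ)) := by
    funext a b
    simp only [Pi.smul_apply, Pi.add_apply, smul_eq_mul]
    ring
  have hr : ∀ (c : ℂ) (F F' H : T2 ℂ), ip2 g x H (F + c • F') = ip2 g x H F + c * ip2 g x H F' := by
    intro c F F' H
    rw [hg.ip2_comm, ip2_add_left, ip2_smul_left, hg.ip2_comm F, hg.ip2_comm F']
  rw [h1, ip2_smul_left, hg.ip2_comm, ip2_smul_left, hr, ip2_add_left, ip2_add_left, ip2_smul_left,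
    ip2_smul_left, hg.ip2_comm (fun a b => (S a b : ℂ)) (fun a b => (P a b : ℂ))]
  simp only [ip2_ofReal]
  push_cast
  linear_combination c ^ 2 * ((ip2 g x S S : ℝ) : ℂ) * Complex.I_sq

end Frame

/-! ### The Hodge dual of a simple 2-form -/

section Hodge

variable {g : Metric} {x : Pt}

/-- The determinant of four row vectors. -/
def det4 (X Y Z W : T1 ℝ) : ℝ := (Matrix.of ![X, Y, Z, W]).det

lemma det_eq_sum_updateRow (A : Matrix (Fin 4) (Fin 4) ℝ) (i : Fin 4) :
    A.det = ∑ j, A i j * (A.updateRow i (Pi.single j 1)).det := by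
  rw [Matrix.det_eq_sum_mul_adjugate_row A i]
  simp only [Matrix.adjugate_apply]

lemma eps_eq_det4 (a b c d : Fin 4) :
    eps a b c d = det4 (Pi.single a 1) (Pi.single b 1) (Pi.single c 1) (Pi.single d 1) := by
  unfold eps det4
  congr 1
  ext r s
  fin_cases r <;> simp [Pi.single_apply] <;> rfl

lemma det4_eq_sum₁ (X Y Z W : T1 ℝ) : det4 X Y Z W = ∑ a, X a * det4 (Pi.single a 1) Y Z W := by
  unfold det4
  rw [det_eq_sum_updateRow _ 0]
  refine Finset.sum_congr rfl fun a _ => ?_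
  congr 2
  ext r s
  fin_cases r <;> rfl

lemma det4_eq_sum₂ (X Y Z W : T1 ℝ) : det4 X Y Z W = ∑ a, Y a * det4 X (Pi.single a 1) Z W := by
  unfold det4
  rw [det_eq_sum_updateRow _ 1]
  refine Finset.sum_congr rfl fun a _ => ?_
  congr 2
  ext r s
  fin_cases r <;> rfl

lemma det4_eq_sum₃ (X Y Z W : T1 ℝ) : det4 X Y Z W = ∑ a, Z a * det4 X Y (Pi.single a 1) W := by
  unfold det4
  rw [det_eq_sum_updateRow _ 2]
  refine Finset.sum_congr rfl fun a _ => ?_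
  congr 2
  ext r s
  fin_cases r <;> rfl

lemma det4_eq_sum₄ (X Y Z W : T1 ℝ) : det4 X Y Z W = ∑ a, W a * det4 X Y Z (Pi.single a 1) := by
  unfold det4
  rw [det_eq_sum_updateRow _ 3]
  refine Finset.sum_congr rfl fun a _ => ?_
  congr 2
  ext r s
  fin_cases r <;> rfl

lemma det4_swap₁₂ (X Y Z W : T1 ℝ) : det4 Y X Z W = -det4 X Y Z W := by
  have h : Matrix.of ![Y, X, Z, W]
      = (Matrix.of ![X, Y, Z, W]).submatrix (Equiv.swap (0 : Fin 4) 1) id := by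
    ext i j
    fin_cases i <;> rfl
  rw [det4, h, Matrix.det_permute, Equiv.Perm.sign_swap (by decide)]
  simp [det4]

lemma det4_swap₃₄ (X Y Z W : T1 ℝ) : det4 X Y W Z = -det4 X Y Z W := by
  have h : Matrix.of ![X, Y, W, Z]
      = (Matrix.of ![X, Y, Z, W]).submatrix (Equiv.swap (2 : Fin 4) 3) id := by
    ext i j
    fin_cases i <;> rfl
  rw [det4, h, Matrix.det_permute, Equiv.Perm.sign_swap (by decide)]
  simp [det4]

/-- The Hodge dual of `v ∧ w` is obtained by inserting `v` and `w` in the volume element. -/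
lemma star_wedge (v w : T1 ℝ) (a b : Fin 4) :
    star g x (wedge v w) a b = Real.sqrt |(g x).det|
      * det4 (Pi.single a 1) (Pi.single b 1) (raise g x v) (raise g x w) := by
  have hr : ∀ c d : Fin 4, raise2 g x (wedge v w) c d
      = raise g x v c * raise g x w d - raise g x w c * raise g x v d := by
    intro a b
    simp only [raise2, wedge, raise, Finset.sum_mul_sum, ← Finset.sum_sub_distrib,
      Algebra.algebraMap_self, RingHom.id_apply]
    exact Finset.sum_congr rfl fun c _ => Finset.sum_congr rfl fun d _ => by ring
  have h1 : ∀ v w : T1 ℝ, det4 (Pi.single a 1) (Pi.single b 1) (raise g x v) (raise g x w)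
      = ∑ c, ∑ d, raise g x v c * (raise g x w d * eps a b c d) := by
    intro v w
    rw [det4_eq_sum₃]
    refine Finset.sum_congr rfl fun c _ => ?_
    rw [det4_eq_sum₄, Finset.mul_sum]
    simp only [eps_eq_det4]
  have h2 : star g x (wedge v w) a b = Real.sqrt |(g x).det| * (1 / 2) *
      (∑ c, ∑ d, raise g x v c * (raise g x w d * eps a b c d)
        - ∑ c, ∑ d, raise g x w c * (raise g x v d * eps a b c d)) := by
    simp only [star, hr, vol, Finset.mul_sum, ← Finset.sum_sub_distrib, Algebra.algebraMap_self,
      RingHom.id_apply]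
    exact Finset.sum_congr rfl fun c _ => Finset.sum_congr rfl fun d _ => by ring
  rw [h2, ← h1, ← h1, det4_swap₃₄ _ _ (raise g x v)]
  ring

lemma sum_star_wedge (v w : T1 ℝ) (X Y : T1 ℝ) :
    ∑ a, ∑ b, star g x (wedge v w) a b * X a * Y b
      = Real.sqrt |(g x).det| * det4 X Y (raise g x v) (raise g x w) := by
  rw [det4_eq_sum₁, Finset.mul_sum]
  refine Finset.sum_congr rfl fun a _ => ?_
  rw [det4_eq_sum₂, Finset.mul_sum, Finset.mul_sum]
  refine Finset.sum_congr rfl fun b _ => ?_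
  rw [star_wedge]
  ring

/-- For a null frame `l, k, e, f` the dual of `l ∧ e` is `± l ∧ f`. -/
lemma IsNullFrame.star_wedge (hg : IsLorentzAt g x) {l k e f : T1 ℝ}
    (h : IsNullFrame g x l k e f) :
    ∃ s : ℝ, s ^ 2 = 1 ∧ star g x (wedge l e) = wedge l (s • f) := by
  set D := Real.sqrt |(g x).det| with hD
  set l' := raise g x l with hl'
  set k' := raise g x k with hk'
  set e' := raise g x e with he'
  set f' := raise g x f with hf'
  have hrow : ∀ (X Y Z W : T1 ℝ) (i j : Fin 4), i ≠ j →
      ![X, Y, Z, W] i = ![X, Y, Z, W] j → det4 X Y Z W = 0 := fun X Y Z W i j hij hXY =>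
    Matrix.det_zero_of_row_eq hij hXY
  have hcomp := h.completeness hg
  -- The components of the dual in the frame.
  have hS : ∀ a b, star g x (wedge l e) a b = D * det4 f' k' l' e' * (f a * l b * (-1) + l a * f b)
      := by
    intro a b
    have e1 : star g x (wedge l e) a b = ∑ c, ∑ d, star g x (wedge l e) c d
        * (if c = a then 1 else 0) * (if d = b then 1 else 0) := by simp
    have e2 : ∀ X Y : T1 ℝ, ∑ c, ∑ d, star g x (wedge l e) c d * X c * Y d = D * det4 X Y l' e' :=
      fun X Y => sum_star_wedge l e X Y
    have e3 : star g x (wedge l e) a b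
        = k a * k b * (D * det4 l' l' l' e') + k a * l b * (D * det4 l' k' l' e')
        - k a * e b * (D * det4 l' e' l' e') - k a * f b * (D * det4 l' f' l' e')
        + l a * k b * (D * det4 k' l' l' e') + l a * l b * (D * det4 k' k' l' e')
        - l a * e b * (D * det4 k' e' l' e') - l a * f b * (D * det4 k' f' l' e')
        - e a * k b * (D * det4 e' l' l' e') - e a * l b * (D * det4 e' k' l' e')
        + e a * e b * (D * det4 e' e' l' e') + e a * f b * (D * det4 e' f' l' e')
        - f a * k b * (D * det4 f' l' l' e') - f a * l b * (D * det4 f' k' l' e')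
        + f a * e b * (D * det4 f' e' l' e') + f a * f b * (D * det4 f' f' l' e') := by
      rw [e1]
      simp only [← e2, ← hcomp, Finset.mul_sum, ← Finset.sum_sub_distrib, ← Finset.sum_add_distrib]
      exact Finset.sum_congr rfl fun c _ => Finset.sum_congr rfl fun d _ => by ring
    rw [e3, hrow l' l' l' e' 0 1 (by decide) rfl, hrow l' k' l' e' 0 2 (by decide) rfl,
      hrow l' e' l' e' 0 2 (by decide) rfl, hrow l' f' l' e' 0 2 (by decide) rfl,
      hrow k' l' l' e' 1 2 (by decide) rfl, hrow k' k' l' e' 0 1 (by decide) rfl,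
      hrow k' e' l' e' 1 3 (by decide) rfl, hrow e' l' l' e' 0 3 (by decide) rfl,
      hrow e' k' l' e' 0 3 (by decide) rfl, hrow e' e' l' e' 0 1 (by decide) rfl,
      hrow e' f' l' e' 0 3 (by decide) rfl, hrow f' l' l' e' 1 2 (by decide) rfl,
      hrow f' e' l' e' 1 3 (by decide) rfl, hrow f' f' l' e' 0 1 (by decide) rfl,
      det4_swap₁₂ f' k' l' e']
    ring
  refine ⟨D * det4 f' k' l' e', ?_, ?_⟩
  · -- The square of the determinant is the Gram determinant of the frame.
    have hD2 : D ^ 2 = -(g x).det := by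
      rw [hD, Real.sq_sqrt (abs_nonneg _), abs_of_neg hg.det_neg]
    have hgram : Matrix.of ![f', k', l', e'] * g x * (Matrix.of ![f', k', l', e']).transpose
        = !![1, 0, 0, 0; 0, 0, -1, 0; 0, -1, 0, 0; 0, 0, 0, 1] := by
      ext i j
      have hG : ∀ u v : T1 ℝ, ∑ b, (∑ a, raise g x u a * g x a b) * raise g x v b = ip g x u v := by
        intro u v
        rw [← hg.sum_g_raise_raise, Finset.sum_comm]
        refine Finset.sum_congr rfl fun b _ => ?_
        rw [Finset.sum_mul]
        exact Finset.sum_congr rfl fun a _ => by ring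
      have kl := (hg.ip_comm k l).trans h.lk
      have el := (hg.ip_comm e l).trans h.le
      have fl := (hg.ip_comm f l).trans h.lf
      have ek := (hg.ip_comm e k).trans h.ke
      have fk := (hg.ip_comm f k).trans h.kf
      have fe := (hg.ip_comm f e).trans h.ef
      rw [Matrix.mul_apply]
      simp only [Matrix.mul_apply, Matrix.transpose_apply]
      fin_cases i <;> fin_cases j <;>
        simp [hl', hk', he', hf', hG, h.ll, h.lk, h.le, h.lf, h.kk, h.ke, h.kf, h.ee, h.ef, h.ff,
          kl, el, fl, ek, fk, fe]
    have hdet := congrArg Matrix.det hgram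
    rw [Matrix.det_mul, Matrix.det_mul, Matrix.det_transpose] at hdet
    have h4 : (!![1, 0, 0, 0; 0, 0, -1, 0; 0, -1, 0, 0; 0, 0, 0, 1] :
        Matrix (Fin 4) (Fin 4) ℝ).det = -1 := by
      simp [Matrix.det_succ_row_zero, Fin.sum_univ_succ, Fin.succAbove]
    rw [h4] at hdet
    unfold det4
    rw [mul_pow, hD2]
    linear_combination -hdet
  · funext a b
    rw [hS]
    simp only [wedge, Pi.smul_apply, smul_eq_mul]
    ring

end Hodge

/-! ### Symmetric tensors with a null eigenvector -/

lemma two_le_rootMultiplicity_of_row_of_col {A : Matrix (Fin 4) (Fin 4) ℝ} {lam : ℝ}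
    (hrow : ∀ j, A 0 j = if 0 = j then lam else 0) (hcol : ∀ i, A i 1 = if i = 1 then lam else 0) :
    2 ≤ A.charpoly.rootMultiplicity lam := by
  rw [Polynomial.le_rootMultiplicity_iff (Matrix.charpoly_monic A).ne_zero]
  have r : ∀ j, A.charmatrix 0 j = if j = 0 then Polynomial.X - Polynomial.C lam else 0 := by
    intro j
    rw [Matrix.charmatrix_apply, hrow]
    fin_cases j <;> simp
  have c : ∀ i, A.charmatrix i 1 = if i = 1 then Polynomial.X - Polynomial.C lam else 0 := by
    intro i
    rw [Matrix.charmatrix_apply, hcol]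
    fin_cases i <;> simp
  rw [Matrix.charpoly, Matrix.det_succ_row_zero, Finset.sum_eq_single 0, r, if_pos rfl,
    Matrix.det_succ_column_zero, Finset.sum_eq_single 0]
  · rw [Matrix.submatrix_apply]
    have h1 : A.charmatrix (Fin.succ 0) (Fin.succAbove 0 0) = Polynomial.X - Polynomial.C lam :=
      (c 1).trans (if_pos rfl)
    rw [h1, pow_two]
    simp only [Fin.val_zero, pow_zero, one_mul]
    rw [← mul_assoc]
    exact dvd_mul_right _ _
  · intro i _ hi
    have h1 : A.charmatrix (Fin.succ i) (Fin.succAbove 0 0) = 0 :=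
      (c i.succ).trans (if_neg fun h => hi (Fin.succ_injective _ h))
    rw [Matrix.submatrix_apply, h1]
    ring
  · simp
  · intro j _ hj
    rw [r, if_neg hj]
    ring
  · simp

/-- A symmetric 2-tensor with a null eigenvector: the eigenvalue is at least double. Indeed `l` is
then both a right and a left eigenvector of the endomorphism, and these are orthogonal. -/
lemma IsNullFrame.two_le_rootMultiplicity {g : Metric} {x : Pt} (hg : IsLorentzAt g x)
    {l k e f : T1 ℝ} (h : IsNullFrame g x l k e f) {S : T2 ℝ} (hS : ∀ a b, S a b = S b a)
    {lam : ℝ} (hlam : ∀ a, ∑ b, S a b * raise g x l b = lam * l a) :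
    2 ≤ (mixed g x S).charpoly.rootMultiplicity lam := by
  set F : Matrix (Fin 4) (Fin 4) ℝ := Matrix.of ![l, k, e, f] with hF
  -- The columns of `P` are the basis dual to the frame.
  set P : Matrix (Fin 4) (Fin 4) ℝ :=
    (Matrix.of ![-raise g x k, -raise g x l, raise g x e, raise g x f]).transpose with hP
  have hPF : P * F = 1 := by
    ext a b
    rw [Matrix.mul_apply, Matrix.one_apply, ← h.completeness hg]
    simp [hP, hF, Fin.sum_univ_four]
  have hFP : F * P = 1 := mul_eq_one_comm.mp hPF
  have hconj : (F * mixed g x S * P).charpoly = (mixed g x S).charpoly := by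
    rw [Matrix.mul_assoc, Matrix.charpoly_mul_comm, Matrix.mul_assoc, hPF, Matrix.mul_one]
  have hright : ∀ a, ∑ b, mixed g x S a b * raise g x l b = lam * raise g x l a := by
    intro a
    have h1 : ∀ a, ∑ b, mixed g x S a b * raise g x l b
        = ∑ c, ginv g x a c * ∑ b, S c b * raise g x l b := by
      intro a
      simp only [mixed, Matrix.of_apply, Finset.sum_mul, Finset.mul_sum]
      rw [Finset.sum_comm]
      exact Finset.sum_congr rfl fun b _ => Finset.sum_congr rfl fun c _ => by ring
    rw [h1]
    simp only [hlam]
    simp only [raise, Finset.mul_sum]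
    exact Finset.sum_congr rfl fun b _ => by ring
  have hleft : ∀ b, ∑ a, l a * mixed g x S a b = lam * l b := by
    intro b
    rw [← hlam]
    simp only [mixed, Matrix.of_apply, raise, Finset.mul_sum]
    rw [Finset.sum_comm]
    refine Finset.sum_congr rfl fun c _ => Finset.sum_congr rfl fun a _ => ?_
    rw [hg.ginv_symm a c, hS c b]
    ring
  have hcol : ∀ i, (F * mixed g x S * P) i 1 = if i = 1 then lam else 0 := by
    intro i
    have h1 := Matrix.ext_iff.mpr hFP i 1
    rw [Matrix.mul_apply, Matrix.one_apply] at h1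
    rw [Matrix.mul_assoc, Matrix.mul_apply]
    have h2 : ∀ a, (mixed g x S * P) a 1 = lam * P a 1 := by
      intro a
      rw [Matrix.mul_apply]
      simp only [hP, Matrix.transpose_apply, Matrix.of_apply, Matrix.cons_val_one, Pi.neg_apply,
        Matrix.cons_val_zero, mul_neg, Finset.sum_neg_distrib, hright]
    simp only [h2]
    calc _ = lam * ∑ j, F i j * P j 1 := by
          rw [Finset.mul_sum]
          exact Finset.sum_congr rfl fun _ _ => by ring
      _ = _ := by rw [h1]; simp
  have hrow : ∀ j, (F * mixed g x S * P) 0 j = if 0 = j then lam else 0 := by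
    intro j
    have h1 := Matrix.ext_iff.mpr hFP 0 j
    rw [Matrix.mul_apply, Matrix.one_apply] at h1
    rw [Matrix.mul_apply]
    have h2 : ∀ a, (F * mixed g x S) 0 a = lam * F 0 a := by
      intro a
      rw [Matrix.mul_apply]
      exact hleft a
    simp only [h2]
    calc _ = lam * ∑ i, F 0 i * P i j := by
          rw [Finset.mul_sum]
          exact Finset.sum_congr rfl fun _ _ => by ring
      _ = _ := by rw [h1]; simp
  rw [← hconj]
  exact two_le_rootMultiplicity_of_row_of_col hrow hcol

/-! ### Calculus in a coordinate domain -/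

section Calculus

variable {U : Set Pt} {x : Pt}

lemma pd_add {u v : Pt → ℝ} (hu : DifferentiableAt ℝ u x) (hv : DifferentiableAt ℝ v x)
    (i : Fin 4) : pd i (fun y => u y + v y) x = pd i u x + pd i v x := by
  simp only [pd, fderiv_fun_add hu hv, add_apply]

lemma pd_sub {u v : Pt → ℝ} (hu : DifferentiableAt ℝ u x) (hv : DifferentiableAt ℝ v x)
    (i : Fin 4) : pd i (fun y => u y - v y) x = pd i u x - pd i v x := by
  simp only [pd, fderiv_fun_sub hu hv, sub_apply]

lemma pd_mul {u v : Pt → ℝ} (hu : DifferentiableAt ℝ u x) (hv : DifferentiableAt ℝ v x)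
    (i : Fin 4) : pd i (fun y => u y * v y) x = pd i u x * v x + u x * pd i v x := by
  simp only [pd, fderiv_fun_mul hu hv, add_apply, smul_apply, smul_eq_mul]
  ring

lemma pd_const_mul {u : Pt → ℝ} (hu : DifferentiableAt ℝ u x) (c : ℝ)
    (i : Fin 4) : pd i (fun y => c * u y) x = c * pd i u x := by
  simp only [pd, fderiv_const_mul hu c, smul_apply, smul_eq_mul]

lemma pd_sum {ι : Type*} {s : Finset ι} {u : ι → Pt → ℝ} (hu : ∀ j ∈ s, DifferentiableAt ℝ (u j) x)
    (i : Fin 4) : pd i (fun y => ∑ j ∈ s, u j y) x = ∑ j ∈ s, pd i (u j) x := by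
  simp only [pd, fderiv_fun_sum hu, sum_apply]

lemma pd_congr {u v : Pt → ℝ} (hU : IsOpen U) (hx : x ∈ U) (h : ∀ y ∈ U, u y = v y) (i : Fin 4) :
    pd i u x = pd i v x := by
  have : u =ᶠ[nhds x] v := Filter.eventually_of_mem (hU.mem_nhds hx) h
  simp only [pd, this.fderiv_eq]

lemma pd_const (c : ℝ) (i : Fin 4) : pd i (fun _ => c) x = 0 := by simp [pd]

lemma differentiableAt_of_contDiffOn {u : Pt → ℝ} (hU : IsOpen U) (hx : x ∈ U)
    (hu : ContDiffOn ℝ ∞ u U) : DifferentiableAt ℝ u x :=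
  (hu.contDiffAt (hU.mem_nhds hx)).differentiableAt (by simp)

lemma contDiffOn_pd {u : Pt → ℝ} (hU : IsOpen U) (hu : ContDiffOn ℝ ∞ u U) (i : Fin 4) :
    ContDiffOn ℝ ∞ (pd i u) U :=
  (hu.fderiv_of_isOpen hU (by simp)).clm_apply contDiffOn_const

lemma pd_comm {u : Pt → ℝ} (hU : IsOpen U) (hx : x ∈ U) (hu : ContDiffOn ℝ ∞ u U) (i j : Fin 4) :
    pd i (pd j u) x = pd j (pd i u) x := by
  have hd : DifferentiableAt ℝ (fderiv ℝ u) x :=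
    ((hu.fderiv_of_isOpen hU (m := ∞) (by simp)).contDiffAt (hU.mem_nhds hx)).differentiableAt
      (by simp)
  have hs : IsSymmSndFDerivAt ℝ u x :=
    (hu.contDiffAt (hU.mem_nhds hx)).isSymmSndFDerivAt (by
      rw [minSmoothness_of_isRCLikeNormedField]
      exact WithTop.coe_le_coe.mpr le_top)
  have h1 : ∀ i j, pd i (pd j u) x
      = fderiv ℝ (fderiv ℝ u) x (EuclideanSpace.single i 1) (EuclideanSpace.single j 1) := by
    intro i j
    have : pd j u = fun y => fderiv ℝ u y (EuclideanSpace.single j 1) := rfl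
    rw [pd, this, fderiv_clm_apply hd (differentiableAt_const _)]
    simp
  rw [h1, h1]
  exact hs _ _

end Calculus

/-- The metric `g` has smooth components and Lorentzian signature on the open set `U`. -/
structure IsLorentzOn (g : Metric) (U : Set Pt) : Prop where
  isOpen : IsOpen U
  symm : ∀ x a b, g x a b = g x b a
  smooth : ∀ a b, ContDiffOn ℝ ∞ (fun x => g x a b) U
  lorentz : ∀ x ∈ U, IsLorentzAt g x

namespace IsLorentzOn

variable {g : Metric} {U : Set Pt}

lemma contDiffOn_det (hg : IsLorentzOn g U) : ContDiffOn ℝ ∞ (fun x => (g x).det) U := by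
  simp only [Matrix.det_apply]
  exact ContDiffOn.sum fun σ _ => (contDiffOn_prod fun i _ => hg.smooth _ _).const_smul _

lemma contDiffOn_ginv (hg : IsLorentzOn g U) (a b : Fin 4) :
    ContDiffOn ℝ ∞ (fun x => ginv g x a b) U := by
  have h1 : ∀ x, ginv g x a b = ((g x).det)⁻¹ * (g x).adjugate a b := by
    intro x
    rw [ginv, Matrix.inv_def, Ring.inverse_eq_inv', Matrix.smul_apply, smul_eq_mul]
  simp only [h1]
  refine (hg.contDiffOn_det.inv fun x hx => (hg.lorentz x hx).det_neg.ne).mul ?_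
  simp only [Matrix.adjugate_apply, Matrix.det_apply]
  refine ContDiffOn.sum fun σ _ => (contDiffOn_prod fun i _ => ?_).const_smul _
  by_cases h : σ i = b
  · simp only [h, Matrix.updateRow_self]
    exact contDiffOn_const
  · simp only [Matrix.updateRow_ne h]
    exact hg.smooth _ _

lemma contDiffOn_christoffel (hg : IsLorentzOn g U) (k i j : Fin 4) :
    ContDiffOn ℝ ∞ (christoffel g k i j) U := by
  unfold christoffel
  exact contDiffOn_const.mul <| ContDiffOn.sum fun m _ => (hg.contDiffOn_ginv _ _).mul
    (((contDiffOn_pd hg.isOpen (hg.smooth _ _) _).add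
      (contDiffOn_pd hg.isOpen (hg.smooth _ _) _)).sub
      (contDiffOn_pd hg.isOpen (hg.smooth _ _) _))

lemma contDiffOn_vol (hg : IsLorentzOn g U) (a b c d : Fin 4) :
    ContDiffOn ℝ ∞ (fun x => vol g x a b c d) U := by
  unfold vol
  refine ContDiffOn.mul (ContDiffOn.sqrt (ContDiffOn.congr hg.contDiffOn_det.neg fun x hx =>
    abs_of_neg (hg.lorentz x hx).det_neg) fun x hx => ?_) contDiffOn_const
  exact (abs_pos.mpr (hg.lorentz x hx).det_neg.ne).ne'

lemma contDiffOn_star (hg : IsLorentzOn g U) {F : Pt → T2 ℝ}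
    (hF : ∀ a b, ContDiffOn ℝ ∞ (fun x => F x a b) U) (a b : Fin 4) :
    ContDiffOn ℝ ∞ (fun x => star g x (F x) a b) U := by
  simp only [star, raise2, Algebra.algebraMap_self, RingHom.id_apply]
  exact ContDiffOn.sum fun c _ => ContDiffOn.sum fun d _ =>
    (contDiffOn_const.mul (hg.contDiffOn_vol a b c d)).mul <|
      ContDiffOn.sum fun p _ => ContDiffOn.sum fun q _ =>
        ((hg.contDiffOn_ginv _ _).mul (hg.contDiffOn_ginv _ _)).mul (hF _ _)

lemma contDiffOn_nabla1 (hg : IsLorentzOn g U) {u : Pt → T1 ℝ}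
    (hu : ∀ a, ContDiffOn ℝ ∞ (fun x => u x a) U) (i a : Fin 4) :
    ContDiffOn ℝ ∞ (fun x => nabla1 g u x i a) U :=
  (contDiffOn_pd hg.isOpen (hu a) i).sub <| ContDiffOn.sum fun k _ =>
    (hg.contDiffOn_christoffel k i a).mul (hu k)

lemma christoffel_symm (hg : IsLorentzOn g U) (k i j : Fin 4) :
    christoffel g k i j = christoffel g k j i := by
  funext x
  unfold christoffel
  have h : (fun y => g y i j) = fun y => g y j i := funext fun y => hg.symm y i j
  rw [h]
  congr 1
  exact Finset.sum_congr rfl fun m _ => by ring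

lemma sum_g_mul_christoffel (hg : IsLorentzOn g U) {x : Pt} (hx : x ∈ U) (c i d : Fin 4) :
    ∑ m, g x c m * christoffel g m i d x = (1 / 2) *
      (pd i (fun y => g y d c) x + pd d (fun y => g y i c) x - pd c (fun y => g y i d) x) := by
  simp only [christoffel, Finset.mul_sum]
  rw [Finset.sum_comm]
  have h1 : ∀ n, ∑ m, g x c m * (1 / 2 * (ginv g x m n *
      (pd i (fun y => g y d n) x + pd d (fun y => g y i n) x - pd n (fun y => g y i d) x)))
      = (if c = n then 1 else 0) * (1 / 2 *
      (pd i (fun y => g y d n) x + pd d (fun y => g y i n) x - pd n (fun y => g y i d) x)) := by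
    intro n
    rw [← (hg.lorentz x hx).sum_g_mul_ginv, Finset.sum_mul]
    exact Finset.sum_congr rfl fun m _ => by ring
  simp only [h1]
  simp

/-- The covariant derivative of the inverse metric vanishes. -/
lemma pd_ginv (hg : IsLorentzOn g U) {x : Pt} (hx : x ∈ U) (i a b : Fin 4) :
    pd i (fun y => ginv g y a b) x = -∑ c, (christoffel g a i c x * ginv g x c b
      + christoffel g b i c x * ginv g x a c) := by
  have hl := hg.lorentz x hx
  have dg : ∀ a b, DifferentiableAt ℝ (fun y => g y a b) x := fun a b =>
    differentiableAt_of_contDiffOn hg.isOpen hx (hg.smooth a b)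
  have dh : ∀ a b, DifferentiableAt ℝ (fun y => ginv g y a b) x := fun a b =>
    differentiableAt_of_contDiffOn hg.isOpen hx (hg.contDiffOn_ginv a b)
  set G : Matrix (Fin 4) (Fin 4) ℝ := Matrix.of fun m d => christoffel g m i d x with hG
  set D : Matrix (Fin 4) (Fin 4) ℝ := Matrix.of fun c d => pd i (fun y => g y c d) x with hD
  set H' : Matrix (Fin 4) (Fin 4) ℝ := Matrix.of fun c d => pd i (fun y => ginv g y c d) x with hH
  have h1 : D = g x * G + G.transpose * g x := by
    ext c d
    have e1 := hg.sum_g_mul_christoffel hx c i d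
    have e2 := hg.sum_g_mul_christoffel hx d i c
    have e3 : (fun y => g y c d) = fun y => g y d c := funext fun y => hg.symm y c d
    simp only [Matrix.add_apply, Matrix.mul_apply, Matrix.transpose_apply, hG, hD, Matrix.of_apply]
    simp only [mul_comm (christoffel g _ i c x), hg.symm x _ d]
    have e4 : (fun y => g y i c) = fun y => g y c i := funext fun y => hg.symm y i c
    have e5 : (fun y => g y i d) = fun y => g y d i := funext fun y => hg.symm y i d
    rw [e1, e2, e3, e4, e5]
    ring
  have h2 : H' * g x + ginv g x * D = 0 := by
    ext c d
    have e1 : pd i (fun y => ∑ m, ginv g y c m * g y m d) x = 0 := by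
      rw [pd_congr (v := fun _ => if c = d then 1 else 0) hg.isOpen hx fun y hy =>
        (hg.lorentz y hy).sum_ginv_mul_g c d]
      exact pd_const _ i
    rw [pd_sum fun m _ => (dh c m).fun_mul (dg m d)] at e1
    simp only [pd_mul (dh _ _) (dg _ _), Finset.sum_add_distrib] at e1
    rw [Matrix.zero_apply, Matrix.add_apply, Matrix.mul_apply, Matrix.mul_apply]
    exact e1
  have hgi : g x * ginv g x = 1 := Matrix.mul_nonsing_inv _ hl.isUnit_det
  have hig : ginv g x * g x = 1 := Matrix.nonsing_inv_mul _ hl.isUnit_det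
  have h3 : H' = -(G * ginv g x + ginv g x * G.transpose) := by
    have e1 : H' * g x = -(ginv g x * D) := eq_neg_of_add_eq_zero_left h2
    calc H' = H' * g x * ginv g x := by rw [Matrix.mul_assoc, hgi, Matrix.mul_one]
      _ = -(ginv g x * (g x * G + G.transpose * g x) * ginv g x) := by
          rw [e1, h1, Matrix.neg_mul]
      _ = -((ginv g x * g x) * G * ginv g x + ginv g x * G.transpose * (g x * ginv g x)) := by
          simp only [Matrix.mul_add, Matrix.add_mul, Matrix.mul_assoc]
      _ = _ := by rw [hig, hgi, Matrix.one_mul, Matrix.mul_one]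
  have h4 := Matrix.ext_iff.mpr h3 a b
  simp only [hH, Matrix.of_apply, Matrix.neg_apply, Matrix.add_apply, Matrix.mul_apply,
    Matrix.transpose_apply, hG] at h4
  rw [h4, ← Finset.sum_add_distrib]
  congr 1
  exact Finset.sum_congr rfl fun c _ => by ring

/-- The Levi-Civita connection is compatible with the scalar product of covectors. -/
lemma pd_ip (hg : IsLorentzOn g U) {x : Pt} (hx : x ∈ U) {u v : Pt → T1 ℝ}
    (hu : ∀ a, ContDiffOn ℝ ∞ (fun x => u x a) U) (hv : ∀ a, ContDiffOn ℝ ∞ (fun x => v x a) U)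
    (i : Fin 4) : pd i (fun y => ip g y (u y) (v y)) x
      = ip g x (nabla1 g u x i) (v x) + ip g x (u x) (nabla1 g v x i) := by
  have dh : ∀ a b, DifferentiableAt ℝ (fun y => ginv g y a b) x := fun a b =>
    differentiableAt_of_contDiffOn hg.isOpen hx (hg.contDiffOn_ginv a b)
  have du : ∀ a, DifferentiableAt ℝ (fun y => u y a) x := fun a =>
    differentiableAt_of_contDiffOn hg.isOpen hx (hu a)
  have dv : ∀ a, DifferentiableAt ℝ (fun y => v y a) x := fun a =>
    differentiableAt_of_contDiffOn hg.isOpen hx (hv a)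
  have h1 : pd i (fun y => ip g y (u y) (v y)) x = ∑ a, ∑ b,
      (pd i (fun y => ginv g y a b) x * u x a * v x b
        + ginv g x a b * pd i (fun y => u y a) x * v x b
        + ginv g x a b * u x a * pd i (fun y => v y b) x) := by
    unfold ip
    rw [pd_sum fun a _ => DifferentiableAt.fun_sum fun b _ => ((dh a b).fun_mul (du a)).fun_mul (dv b)]
    refine Finset.sum_congr rfl fun a _ => ?_
    rw [pd_sum fun b _ => ((dh a b).fun_mul (du a)).fun_mul (dv b)]
    refine Finset.sum_congr rfl fun b _ => ?_
    rw [pd_mul ((dh a b).fun_mul (du a)) (dv b), pd_mul (dh a b) (du a)]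
    ring
  rw [h1]
  simp only [hg.pd_ginv hx, ip, nabla1, Fin.sum_univ_four]
  ring

lemma nabla2_wedge (hg : IsLorentzOn g U) {x : Pt} (hx : x ∈ U) {u v : Pt → T1 ℝ}
    (hu : ∀ a, ContDiffOn ℝ ∞ (fun x => u x a) U) (hv : ∀ a, ContDiffOn ℝ ∞ (fun x => v x a) U)
    {F : Pt → T2 ℝ} (hF : ∀ y ∈ U, F y = wedge (u y) (v y)) (i : Fin 4) :
    nabla2 g F x i = wedge (nabla1 g u x i) (v x) + wedge (u x) (nabla1 g v x i) := by
  have du : ∀ a, DifferentiableAt ℝ (fun y => u y a) x := fun a =>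
    differentiableAt_of_contDiffOn hg.isOpen hx (hu a)
  have dv : ∀ a, DifferentiableAt ℝ (fun y => v y a) x := fun a =>
    differentiableAt_of_contDiffOn hg.isOpen hx (hv a)
  funext a b
  have h1 : pd i (fun y => F y a b) x
      = pd i (fun y => u y a * v y b - v y a * u y b) x := by
    refine pd_congr hg.isOpen hx (fun y hy => ?_) i
    rw [hF y hy, wedge]
  simp only [nabla2, Pi.add_apply]
  rw [h1, pd_sub ((du a).fun_mul (dv b)) ((dv a).fun_mul (du b)), pd_mul (du a) (dv b),
    pd_mul (dv a) (du b), hF x hx]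
  simp only [wedge, nabla1, Fin.sum_univ_four]
  ring

/-- The Ricci identity for a field of covectors. -/
lemma ricci_identity (hg : IsLorentzOn g U) {x : Pt} (hx : x ∈ U) {l : Pt → T1 ℝ}
    (hl : ∀ a, ContDiffOn ℝ ∞ (fun x => l x a) U) (b c d : Fin 4) :
    ∑ a, riemannUp g a b c d x * l x a
      = (pd d (fun y => nabla1 g l y c b) x - ∑ k, christoffel g k d b x * nabla1 g l x c k)
        - (pd c (fun y => nabla1 g l y d b) x - ∑ k, christoffel g k c b x * nabla1 g l x d k) := by
  have dl : ∀ a, DifferentiableAt ℝ (fun y => l y a) x := fun a =>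
    differentiableAt_of_contDiffOn hg.isOpen hx (hl a)
  have dG : ∀ k i j, DifferentiableAt ℝ (fun y => christoffel g k i j y) x := fun k i j =>
    differentiableAt_of_contDiffOn hg.isOpen hx (hg.contDiffOn_christoffel k i j)
  have h1 : ∀ c d, pd c (fun y => nabla1 g l y d b) x = pd c (pd d fun y => l y b) x
      - ∑ k, (pd c (christoffel g k d b) x * l x k
        + christoffel g k d b x * pd c (fun y => l y k) x) := by
    intro c d
    unfold nabla1
    rw [pd_sub (differentiableAt_of_contDiffOn hg.isOpen hx (contDiffOn_pd hg.isOpen (hl b) d))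
      (DifferentiableAt.fun_sum fun k _ => (dG k d b).fun_mul (dl k)),
      pd_sum fun k _ => (dG k d b).fun_mul (dl k)]
    simp only [pd_mul (dG _ _ _) (dl _)]
  rw [h1, h1, pd_comm hg.isOpen hx (hl b) d c]
  simp only [nabla1, riemannUp, Fin.sum_univ_four]
  ring

/-- The first Bianchi identity. -/
lemma bianchi (hg : IsLorentzOn g U) (x : Pt) (a b c d : Fin 4) :
    riemann g x a b c d + riemann g x a c d b + riemann g x a d b c = 0 := by
  simp only [riemann, ← Finset.sum_add_distrib]
  refine Finset.sum_eq_zero fun e _ => ?_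
  rw [← mul_add, ← mul_add]
  refine mul_eq_zero_of_right _ ?_
  unfold riemannUp
  rw [hg.christoffel_symm e d b, hg.christoffel_symm e c b, hg.christoffel_symm e d c]
  simp only [hg.christoffel_symm _ d b, hg.christoffel_symm _ c b, hg.christoffel_symm _ d c,
    Fin.sum_univ_four]
  ring

end IsLorentzOn

/-! ### Null frames adapted to the fundamental 2-form -/

section Fundamental

variable {g : Metric} {x : Pt}

/-- A null rotation about `l`. -/
lemma IsNullFrame.rotate (hg : IsLorentzAt g x) {l k e f : T1 ℝ} (h : IsNullFrame g x l k e f)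
    (m n : ℝ) : IsNullFrame g x l (k + (m • e + (n • f + ((m ^ 2 + n ^ 2) / 2) • l)))
      (e + m • l) (f + n • l) := by
  have kl := (hg.ip_comm k l).trans h.lk
  have el := (hg.ip_comm e l).trans h.le
  have fl := (hg.ip_comm f l).trans h.lf
  have ek := (hg.ip_comm e k).trans h.ke
  have fk := (hg.ip_comm f k).trans h.kf
  have fe := (hg.ip_comm f e).trans h.ef
  constructor <;>
    simp only [ip_add_left, ip_add_right, ip_smul_left, ip_smul_right, h.ll, h.lk, h.le, h.lf,
      h.kk, h.ke, h.kf, h.ee, h.ef, h.ff, kl, el, fl, ek, fk, fe] <;> ring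

lemma star_zero : star g x (0 : T2 ℝ) = 0 := by
  funext a b
  simp [star, raise2]

/-- The fundamental 2-form and its dual in a null frame. -/
lemma IsFundamentalAt.exists_nullFrame (hg : IsLorentzAt g x) (hW : weyl g x ≠ 0)
    {l : T1 ℝ} {L : T2 ℝ} (h : IsFundamentalAt g x l L) :
    ∃ k e f, IsNullFrame g x l k e f ∧ L = wedge l e ∧ star g x L = wedge l f := by
  obtain ⟨hWL, hll, e, hee, hle, hL⟩ := h
  have hl : l ≠ 0 := by
    rintro rfl
    have hL0 : L = 0 := by
      rw [hL]
      funext a b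
      simp [wedge]
    refine hW ?_
    funext a b c d
    rw [hWL, hL0, star_zero]
    simp
  obtain ⟨k, f, hF⟩ := hg.exists_nullFrame hl hll hle hee
  obtain ⟨s, hs, hstar⟩ := hF.star_wedge hg
  refine ⟨k, e, s • f, ?_, hL, by rw [hL, hstar]⟩
  constructor <;> simp only [ip_smul_left, ip_smul_right, hF.ll, hF.lk, hF.le, hF.lf,
      hF.kk, hF.ke, hF.kf, hF.ee, hF.ef, hF.ff] <;>
    first | ring1 | linear_combination hs

lemma sum_raise_wedge (u v w : T1 ℝ) (b : Fin 4) :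
    ∑ a, raise g x u a * wedge v w a b = ip g x v u * w b - ip g x w u * v b := by
  simp only [wedge, ip_eq_pair_raise, pair, Finset.sum_mul, ← Finset.sum_sub_distrib]
  exact Finset.sum_congr rfl fun a _ => by ring

/-- The fundamental vector is determined up to a factor by the Weyl tensor. -/
lemma IsFundamentalAt.parallel (hg : IsLorentzAt g x) (hW : weyl g x ≠ 0)
    {l l' : T1 ℝ} {L L' : T2 ℝ} (h : IsFundamentalAt g x l L) (h' : IsFundamentalAt g x l' L') :
    ∃ c : ℝ, l' = c • l := by
  obtain ⟨k, e, f, hF, hL, hS⟩ := h.exists_nullFrame hg hW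
  obtain ⟨k', e', f', hF', hL', hS'⟩ := h'.exists_nullFrame hg hW
  have el := (hg.ip_comm e' l').trans hF'.le
  have fl := (hg.ip_comm f' l').trans hF'.lf
  -- `l'` annihilates the Weyl tensor.
  have h0 : ∀ b c d, ∑ a, raise g x l' a * weyl g x a b c d = 0 := by
    intro b c d
    have h1 := sum_raise_wedge (g := g) (x := x) l' l' e' b
    have h2 := sum_raise_wedge (g := g) (x := x) l' l' f' b
    rw [hF'.ll, el] at h1
    rw [hF'.ll, fl] at h2
    calc _ = (∑ a, raise g x l' a * wedge l' e' a b) * wedge l' e' c d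
          - (∑ a, raise g x l' a * wedge l' f' a b) * wedge l' f' c d := by
          simp only [Finset.sum_mul, ← Finset.sum_sub_distrib]
          refine Finset.sum_congr rfl fun a _ => ?_
          rw [h'.1, hS', hL']
          ring
      _ = 0 := by rw [h1, h2]; ring
  have h1 : ∀ b c d, (ip g x l l' * e b - ip g x e l' * l b) * wedge l e c d
      - (ip g x l l' * f b - ip g x f l' * l b) * wedge l f c d = 0 := by
    intro b c d
    rw [← h0 b c d, ← sum_raise_wedge, ← sum_raise_wedge, Finset.sum_mul, Finset.sum_mul,
      ← Finset.sum_sub_distrib]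
    refine Finset.sum_congr rfl fun a _ => ?_
    rw [h.1, hS, hL]
    ring
  have kl := (hg.ip_comm k l).trans hF.lk
  have el := (hg.ip_comm e l).trans hF.le
  have fl := (hg.ip_comm f l).trans hF.lf
  have ek := (hg.ip_comm e k).trans hF.ke
  have fk := (hg.ip_comm f k).trans hF.kf
  have fe := (hg.ip_comm f e).trans hF.ef
  -- Contraction with `k` and with `e`, respectively `f`, separates the two terms.
  have h2 : ∀ (u : T1 ℝ) (b : Fin 4),
      -((ip g x l l' * e b - ip g x e l' * l b) * ip g x e u
        - (ip g x l l' * f b - ip g x f l' * l b) * ip g x f u) = 0 := by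
    intro u b
    have e1 : ∑ d, raise g x u d * ∑ c, raise g x k c *
        ((ip g x l l' * e b - ip g x e l' * l b) * wedge l e c d
          - (ip g x l l' * f b - ip g x f l' * l b) * wedge l f c d) = 0 := by
      simp only [h1, mul_zero, Finset.sum_const_zero]
    have e2 : ∀ d, ∑ c, raise g x k c *
        ((ip g x l l' * e b - ip g x e l' * l b) * wedge l e c d
          - (ip g x l l' * f b - ip g x f l' * l b) * wedge l f c d)
        = -((ip g x l l' * e b - ip g x e l' * l b) * e d
          - (ip g x l l' * f b - ip g x f l' * l b) * f d) := by
      intro d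
      have p1 := sum_raise_wedge (g := g) (x := x) k l e d
      have p2 := sum_raise_wedge (g := g) (x := x) k l f d
      rw [hF.lk, ek] at p1
      rw [hF.lk, fk] at p2
      calc _ = (ip g x l l' * e b - ip g x e l' * l b) * (∑ c, raise g x k c * wedge l e c d)
            - (ip g x l l' * f b - ip g x f l' * l b) * (∑ c, raise g x k c * wedge l f c d) := by
            simp only [Finset.mul_sum, ← Finset.sum_sub_distrib]
            exact Finset.sum_congr rfl fun c _ => by ring
        _ = _ := by rw [p1, p2]; ring
    simp only [e2] at e1
    rw [← e1]
    simp only [ip_eq_pair_raise, pair, Fin.sum_univ_four]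
    ring
  have he : ∀ b, ip g x l l' * e b - ip g x e l' * l b = 0 := fun b => by
    have := h2 e b
    rw [hF.ee, fe] at this
    linarith
  have hf : ∀ b, ip g x l l' * f b - ip g x f l' * l b = 0 := fun b => by
    have := h2 f b
    rw [hF.ef, hF.ff] at this
    linarith
  have hvec : ∀ v : T1 ℝ, (∀ b, ip g x l l' * v b - ip g x v l' * l b = 0) → ∀ u,
      ip g x l l' * ip g x v u = ip g x v l' * ip g x l u := by
    intro v hv u
    rw [← ip_smul_left, ← ip_smul_left]
    congr 1
    funext b
    simpa using sub_eq_zero.mp (hv b)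
  have z1 : ip g x l l' = 0 := by
    have := hvec e he e
    rw [hF.ee, hF.le] at this
    linarith
  have z2 : ip g x e l' = 0 := by
    have := hvec e he k
    rw [z1, hF.lk] at this
    linarith
  have z3 : ip g x f l' = 0 := by
    have := hvec f hf k
    rw [z1, hF.lk] at this
    linarith
  refine ⟨-ip g x l' k, ?_⟩
  funext b
  rw [hF.expand hg l' b, hg.ip_comm l' l, hg.ip_comm l' e, hg.ip_comm l' f, z1, z2, z3]
  simp only [Pi.smul_apply, smul_eq_mul]
  ring

end Fundamental

/-! ### The curvature and the fundamental vector -/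

section Curvature

variable {g : Metric} {U : Set Pt} {x : Pt}

/-- The tensor `Q` is symmetric. This follows from the first Bianchi identity, which the Weyl tensor
satisfies because `L` and `*L` are simple. -/
lemma IsFundamentalAt.tensorQ_symm (hg : IsLorentzOn g U) (hx : x ∈ U) (hW : weyl g x ≠ 0)
    {l : T1 ℝ} {L : T2 ℝ} (h : IsFundamentalAt g x l L) (a b : Fin 4) :
    tensorQ g x a b = tensorQ g x b a := by
  have hl := hg.lorentz x hx
  obtain ⟨k, e, f, hF, hL, hS⟩ := h.exists_nullFrame hl hW
  have hWb : ∀ a b c d, weyl g x a b c d + weyl g x a c d b + weyl g x a d b c = 0 := by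
    intro a b c d
    rw [h.1, h.1, h.1, hS, hL]
    simp only [wedge]
    ring
  have hQ : ∀ a b c d, g x a c * (tensorQ g x b d - tensorQ g x d b)
      + g x a d * (tensorQ g x c b - tensorQ g x b c)
      + g x a b * (tensorQ g x d c - tensorQ g x c d) = 0 := by
    intro a b c d
    have h1 := hWb a b c d
    have h2 := hg.bianchi x a b c d
    simp only [weyl] at h1
    rw [hg.symm x d b, hg.symm x c b, hg.symm x d c] at h1
    linear_combination h2 - h1
  -- For `c` different from `a` and `b`, raising the first index of the identity above to `c` leaves
  -- only its first term.
  obtain ⟨c, hcb, hca⟩ : ∃ c : Fin 4, c ≠ a ∧ c ≠ b := by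
    revert a b
    decide
  have h1 : ∑ p, ginv g x c p * (g x p c * (tensorQ g x a b - tensorQ g x b a)
      + g x p b * (tensorQ g x c a - tensorQ g x a c)
      + g x p a * (tensorQ g x b c - tensorQ g x c b)) = 0 := by
    simp only [hQ, mul_zero, Finset.sum_const_zero]
  simp only [mul_add, Finset.sum_add_distrib, ← mul_assoc, ← Finset.sum_mul, hl.sum_ginv_mul_g,
    if_neg hcb, if_neg hca, if_true] at h1
  linarith

/-- If the derivative of `l` in directions orthogonal to `l` is proportional to `l`, then so is
the curvature of two such directions applied to `l`. -/
lemma IsLorentzOn.riemannUp_of_nabla1 (hg : IsLorentzOn g U) (hx : x ∈ U)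
    {l w s : Pt → T1 ℝ} (hl : ∀ a, ContDiffOn ℝ ∞ (fun x => l x a) U)
    (hw : ∀ a, ContDiffOn ℝ ∞ (fun x => w x a) U) (hs : ∀ a, ContDiffOn ℝ ∞ (fun x => s x a) U)
    (hN : ∀ y ∈ U, ∀ i j, nabla1 g l y i j = w y i * l y j + l y i * s y j) :
    ∃ A X Y : T2 ℝ, ∀ b c d, ∑ a, riemannUp g a b c d x * l x a
      = A c d * l x b + l x d * X c b + l x c * Y d b := by
  have dl : ∀ a, DifferentiableAt ℝ (fun y => l y a) x := fun a =>
    differentiableAt_of_contDiffOn hg.isOpen hx (hl a)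
  have dw : ∀ a, DifferentiableAt ℝ (fun y => w y a) x := fun a =>
    differentiableAt_of_contDiffOn hg.isOpen hx (hw a)
  have ds : ∀ a, DifferentiableAt ℝ (fun y => s y a) x := fun a =>
    differentiableAt_of_contDiffOn hg.isOpen hx (hs a)
  have hpd : ∀ i j, pd i (fun y => l y j) x
      = w x i * l x j + l x i * s x j + ∑ k, christoffel g k i j x * l x k := by
    intro i j
    rw [← hN x hx, nabla1]
    ring
  have hpN : ∀ d c b, pd d (fun y => nabla1 g l y c b) x
      = pd d (fun y => w y c) x * l x b + w x c * pd d (fun y => l y b) x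
        + (pd d (fun y => l y c) x * s x b + l x c * pd d (fun y => s y b) x) := by
    intro d c b
    rw [pd_congr hg.isOpen hx fun y hy => hN y hy c b,
      pd_add ((dw c).fun_mul (dl b)) ((dl c).fun_mul (ds b)), pd_mul (dw c) (dl b),
      pd_mul (dl c) (ds b)]
  refine ⟨fun c d => pd d (fun y => w y c) x - pd c (fun y => w y d) x,
    fun c b => s x c * s x b - nabla1 g s x c b,
    fun d b => nabla1 g s x d b - s x d * s x b, fun b c d => ?_⟩
  rw [hg.ricci_identity hx hl, hpN, hpN]
  simp only [hpd, hN x hx]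
  simp only [nabla1, hg.christoffel_symm _ d c, Fin.sum_univ_four]
  ring

/-- If the curvature maps `l` to a multiple of `l` on pairs of directions orthogonal to `l`, as in
`IsLorentzOn.riemannUp_of_nabla1`, then `l` is an eigenvector of `Q`. Indeed the Weyl tensor is
annihilated by `l`, and `Q(l)` is the rest of the curvature applied to `l`. -/
lemma IsFundamentalAt.tensorQ_eigenvector (hg : IsLorentzOn g U) (hx : x ∈ U) (hW : weyl g x ≠ 0)
    {l : T1 ℝ} {L : T2 ℝ} (h : IsFundamentalAt g x l L) {A X Y : T2 ℝ}
    (hR : ∀ b c d, ∑ a, riemannUp g a b c d x * l a = A c d * l b + l d * X c b + l c * Y d b) :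
    ∃ lam : ℝ, ∀ a, ∑ b, tensorQ g x a b * raise g x l b = lam * l a := by
  have hl := hg.lorentz x hx
  have hsymm := h.tensorQ_symm hg hx hW
  obtain ⟨k, e, f, hF, hL, hS⟩ := h.exists_nullFrame hl hW
  have el := (hl.ip_comm e l).trans hF.le
  have fl := (hl.ip_comm f l).trans hF.lf
  have fe := (hl.ip_comm f e).trans hF.ef
  set q : T1 ℝ := fun a => ∑ b, tensorQ g x a b * raise g x l b with hq
  have hgl : ∀ c, ∑ a, raise g x l a * g x a c = l c := fun c => by
    rw [← hl.sum_g_mul_raise l c]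
    exact Finset.sum_congr rfl fun a _ => by rw [hl.g_symm a c]; ring
  have hql : ∀ c, ∑ a, raise g x l a * tensorQ g x a c = q c := fun c =>
    Finset.sum_congr rfl fun a _ => by rw [hsymm a c]; ring
  have hRl : ∀ b c d, ∑ a, raise g x l a * riemann g x a b c d
      = A c d * l b + l d * X c b + l c * Y d b := by
    intro b c d
    rw [← hR]
    simp only [riemann, Finset.mul_sum]
    rw [Finset.sum_comm]
    refine Finset.sum_congr rfl fun a _ => ?_
    rw [← hgl a, Finset.mul_sum]
    exact Finset.sum_congr rfl fun p _ => by ring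
  have hWl : ∀ b c d, ∑ a, raise g x l a * weyl g x a b c d = 0 := by
    intro b c d
    have h1 := sum_raise_wedge (g := g) (x := x) l l e b
    have h2 := sum_raise_wedge (g := g) (x := x) l l f b
    rw [hF.ll, el] at h1
    rw [hF.ll, fl] at h2
    calc _ = (∑ a, raise g x l a * wedge l e a b) * wedge l e c d
          - (∑ a, raise g x l a * wedge l f a b) * wedge l f c d := by
          simp only [Finset.sum_mul, ← Finset.sum_sub_distrib]
          refine Finset.sum_congr rfl fun a _ => ?_
          rw [h.1, hS, hL]
          ring
      _ = 0 := by rw [h1, h2]; ring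
  have hmain : ∀ b c d, A c d * l b + l d * X c b + l c * Y d b
      = l c * tensorQ g x b d - l d * tensorQ g x b c + g x b d * q c - g x b c * q d := by
    intro b c d
    have h1 := hWl b c d
    have h2 : ∑ a, raise g x l a * weyl g x a b c d
        = ∑ a, raise g x l a * riemann g x a b c d
          - ((∑ a, raise g x l a * g x a c) * tensorQ g x b d
          - (∑ a, raise g x l a * g x a d) * tensorQ g x b c
          + g x b d * (∑ a, raise g x l a * tensorQ g x a c)
          - g x b c * (∑ a, raise g x l a * tensorQ g x a d)) := by
      simp only [weyl, Finset.mul_sum, Finset.sum_mul, ← Finset.sum_sub_distrib,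
        ← Finset.sum_add_distrib]
      exact Finset.sum_congr rfl fun a _ => by ring
    rw [h2, hRl, hgl, hgl, hql, hql] at h1
    linarith
  -- Contraction with directions orthogonal to `l` leaves only `Q(l)`.
  have hperp : ∀ u v w : T1 ℝ, ip g x l u = 0 → ip g x l v = 0 → ip g x l w = 0 →
      ip g x w v * ip g x q u = ip g x w u * ip g x q v := by
    intro u v w hu hv hw
    have h1 : ∑ b, ∑ c, ∑ d, raise g x w b * raise g x u c * raise g x v d *
        (A c d * l b + l d * X c b + l c * Y d b)
        = ∑ b, ∑ c, ∑ d, raise g x w b * raise g x u c * raise g x v d *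
        (l c * tensorQ g x b d - l d * tensorQ g x b c + g x b d * q c - g x b c * q d) := by
      simp only [hmain]
    have gl : ∀ (w : T1 ℝ) c, ∑ b, raise g x w b * g x b c = w c := fun w c => by
      rw [← hl.sum_g_mul_raise w c]
      exact Finset.sum_congr rfl fun a _ => by rw [hl.g_symm a c]; ring
    have h2 : ∑ b, ∑ c, ∑ d, raise g x w b * raise g x u c * raise g x v d *
        (A c d * l b + l d * X c b + l c * Y d b)
        = pair l (raise g x w) * (∑ c, ∑ d, raise g x u c * raise g x v d * A c d)
        + pair l (raise g x v) * (∑ b, ∑ c, raise g x w b * raise g x u c * X c b)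
        + pair l (raise g x u) * (∑ b, ∑ d, raise g x w b * raise g x v d * Y d b) := by
      simp only [pair, Fin.sum_univ_four]
      ring
    have h3 : ∑ b, ∑ c, ∑ d, raise g x w b * raise g x u c * raise g x v d *
        (l c * tensorQ g x b d - l d * tensorQ g x b c + g x b d * q c - g x b c * q d)
        = pair l (raise g x u) * (∑ b, ∑ d, raise g x w b * raise g x v d * tensorQ g x b d)
        - pair l (raise g x v) * (∑ b, ∑ c, raise g x w b * raise g x u c * tensorQ g x b c)
        + pair q (raise g x u) * (∑ d, (∑ b, raise g x w b * g x b d) * raise g x v d)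
        - pair q (raise g x v) * (∑ c, (∑ b, raise g x w b * g x b c) * raise g x u c) := by
      simp only [pair, Fin.sum_univ_four]
      ring
    rw [h2, h3] at h1
    simp only [gl, ← ip_eq_pair_raise, hu, hv, hw] at h1
    have h4 : ∀ v, ∑ d, w d * raise g x v d = ip g x w v := fun v => (ip_eq_pair_raise w v).symm
    rw [h4, h4] at h1
    linarith
  have q1 : ip g x q l = 0 := by
    have := hperp l e e hF.ll hF.le hF.le
    rw [hF.ee, el] at this
    linarith
  have q2 : ip g x q e = 0 := by
    have := hperp e f f hF.le hF.lf hF.lf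
    rw [hF.ff, fe] at this
    linarith
  have q3 : ip g x q f = 0 := by
    have := hperp f e e hF.lf hF.le hF.le
    rw [hF.ee, hF.ef] at this
    linarith
  refine ⟨-ip g x q k, fun a => ?_⟩
  have := hF.expand hl q a
  rw [q1, q2, q3] at this
  change q a = _
  rw [this]
  ring

end Curvature

/-! ### The derivative of the fundamental bivector -/

/-- The fields `l, e, f` are smooth on `U` and are, at each point, part of a null frame in which
`L = l ∧ e` and `*L = l ∧ f`. -/
structure IsAdaptedOn (g : Metric) (U : Set Pt) (l : Pt → T1 ℝ) (L : Pt → T2 ℝ)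
    (e f : Pt → T1 ℝ) : Prop where
  smooth_l : ∀ a, ContDiffOn ℝ ∞ (fun x => l x a) U
  smooth_e : ∀ a, ContDiffOn ℝ ∞ (fun x => e x a) U
  smooth_f : ∀ a, ContDiffOn ℝ ∞ (fun x => f x a) U
  frame : ∀ y ∈ U, ∃ k, IsNullFrame g y (l y) k (e y) (f y)
  L_eq : ∀ y ∈ U, L y = wedge (l y) (e y)
  star_eq : ∀ y ∈ U, starL g L y = wedge (l y) (f y)

lemma contDiffOn_pair {U : Set Pt} {u t : Pt → T1 ℝ} (hu : ∀ a, ContDiffOn ℝ ∞ (fun x => u x a) U)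
    (ht : ∀ a, ContDiffOn ℝ ∞ (fun x => t x a) U) :
    ContDiffOn ℝ ∞ (fun x => pair (u x) (t x)) U :=
  ContDiffOn.sum fun a _ => (hu a).mul (ht a)

section Adapted

variable {g : Metric} {U : Set Pt} {x : Pt} {l e f : Pt → T1 ℝ} {L : Pt → T2 ℝ}

/-- Smooth adapted fields are obtained by inserting a timelike field in `L` and `*L`. -/
lemma IsLorentzOn.exists_isAdaptedOn (hg : IsLorentzOn g U) {t : Pt → T1 ℝ}
    (hW : ∀ y ∈ U, weyl g y ≠ 0)
    (hl : ∀ a, ContDiffOn ℝ ∞ (fun x => l x a) U)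
    (hL : ∀ a b, ContDiffOn ℝ ∞ (fun x => L x a b) U)
    (ht : ∀ a, ContDiffOn ℝ ∞ (fun x => t x a) U)
    (hF : ∀ y ∈ U, IsFundamentalAt g y (l y) (L y))
    (htime : ∀ y ∈ U, ∑ a, ∑ b, g y a b * t y a * t y b < 0) :
    (∀ y ∈ U, pair (l y) (t y) ≠ 0) ∧ ∃ e f, IsAdaptedOn g U l L e f := by
  have hp : ∀ y ∈ U, pair (l y) (t y) ≠ 0 := by
    intro y hy
    obtain ⟨k, e, f, h, -, -⟩ := (hF y hy).exists_nullFrame (hg.lorentz y hy) (hW y hy)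
    exact h.pair_ne_zero (hg.lorentz y hy) (htime y hy)
  have hins : ∀ (y : Pt) (u v : T1 ℝ), pair u (t y) ≠ 0 →
      (fun b => (∑ a, wedge u v a b * t y a) / pair u (t y))
        = v + (-(pair v (t y) / pair u (t y))) • u := by
    intro y u v h
    funext b
    have h1 : ∑ a, wedge u v a b * t y a = pair u (t y) * v b - pair v (t y) * u b := by
      simp only [wedge, pair, Fin.sum_univ_four]
      ring
    rw [h1]
    simp only [Pi.add_apply, Pi.smul_apply, smul_eq_mul]
    field_simp
    ring
  have hwedge : ∀ (u v : T1 ℝ) (c : ℝ), wedge u (v + c • u) = wedge u v := by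
    intro u v c
    funext a b
    simp only [wedge, Pi.add_apply, Pi.smul_apply, smul_eq_mul]
    ring
  refine ⟨hp, fun y b => (∑ a, L y a b * t y a) / pair (l y) (t y),
    fun y b => (∑ a, starL g L y a b * t y a) / pair (l y) (t y), hl, ?_, ?_, ?_, ?_, ?_⟩
  · exact fun b => (ContDiffOn.sum fun a _ => (hL a b).mul (ht a)).div (contDiffOn_pair hl ht) hp
  · exact fun b => (ContDiffOn.sum fun a _ => (hg.contDiffOn_star hL a b).mul (ht a)).div
      (contDiffOn_pair hl ht) hp
  · intro y hy
    obtain ⟨k, e, f, h, h1, h2⟩ := (hF y hy).exists_nullFrame (hg.lorentz y hy) (hW y hy)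
    rw [← starL] at h2
    rw [h1, h2, hins y _ _ (hp y hy), hins y _ _ (hp y hy)]
    exact ⟨_, h.rotate (hg.lorentz y hy) _ _⟩
  · intro y hy
    obtain ⟨k, e, f, h, h1, h2⟩ := (hF y hy).exists_nullFrame (hg.lorentz y hy) (hW y hy)
    simp only [h1]
    rw [hins y _ _ (hp y hy), hwedge]
  · intro y hy
    obtain ⟨k, e, f, h, h1, h2⟩ := (hF y hy).exists_nullFrame (hg.lorentz y hy) (hW y hy)
    rw [← starL] at h2
    simp only [h2]
    rw [hins y _ _ (hp y hy), hwedge]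

/-- The derivative of the covector field `u` in the direction of the covector `v`. -/
def nablaDir (g : Metric) (u : Pt → T1 ℝ) (x : Pt) (v : T1 ℝ) : T1 ℝ := fun a =>
  ∑ i, raise g x v i * nabla1 g u x i a

lemma ip_nablaDir (u : Pt → T1 ℝ) (v w : T1 ℝ) :
    ip g x (nablaDir g u x v) w = ∑ i, raise g x v i * ip g x (nabla1 g u x i) w := by
  simp only [ip_eq_pair_raise, pair, nablaDir, Finset.mul_sum, Finset.sum_mul]
  rw [Finset.sum_comm]
  exact Finset.sum_congr rfl fun a _ => Finset.sum_congr rfl fun b _ => by ring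

/-- The derivative of a constant scalar product. -/
lemma IsLorentzOn.ip_nabla1_add (hg : IsLorentzOn g U) (hx : x ∈ U) {u v : Pt → T1 ℝ} {c : ℝ}
    (hu : ∀ a, ContDiffOn ℝ ∞ (fun x => u x a) U) (hv : ∀ a, ContDiffOn ℝ ∞ (fun x => v x a) U)
    (huv : ∀ y ∈ U, ip g y (u y) (v y) = c) (i : Fin 4) :
    ip g x (nabla1 g u x i) (v x) + ip g x (nabla1 g v x i) (u x) = 0 := by
  rw [(hg.lorentz x hx).ip_comm (nabla1 g v x i), ← hg.pd_ip hx hu hv,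
    pd_congr (v := fun _ => c) hg.isOpen hx huv, pd_const]

namespace IsAdaptedOn

lemma ip_nabla1_l (h : IsAdaptedOn g U l L e f) (hg : IsLorentzOn g U) (hx : x ∈ U) (i : Fin 4) :
    ip g x (nabla1 g l x i) (l x) = 0 := by
  have := hg.ip_nabla1_add hx h.smooth_l h.smooth_l (c := 0)
    (fun y hy => (h.frame y hy).choose_spec.ll) i
  linarith

lemma ip_nabla1_e_l (h : IsAdaptedOn g U l L e f) (hg : IsLorentzOn g U) (hx : x ∈ U)
    (i : Fin 4) : ip g x (nabla1 g e x i) (l x) = -ip g x (nabla1 g l x i) (e x) := by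
  have := hg.ip_nabla1_add hx h.smooth_l h.smooth_e (c := 0)
    (fun y hy => (h.frame y hy).choose_spec.le) i
  linarith

lemma ip_nabla1_f_l (h : IsAdaptedOn g U l L e f) (hg : IsLorentzOn g U) (hx : x ∈ U)
    (i : Fin 4) : ip g x (nabla1 g f x i) (l x) = -ip g x (nabla1 g l x i) (f x) := by
  have := hg.ip_nabla1_add hx h.smooth_l h.smooth_f (c := 0)
    (fun y hy => (h.frame y hy).choose_spec.lf) i
  linarith

lemma ip_nabla1_e (h : IsAdaptedOn g U l L e f) (hg : IsLorentzOn g U) (hx : x ∈ U) (i : Fin 4) :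
    ip g x (nabla1 g e x i) (e x) = 0 := by
  have := hg.ip_nabla1_add hx h.smooth_e h.smooth_e (c := 1)
    (fun y hy => (h.frame y hy).choose_spec.ee) i
  linarith

lemma ip_nabla1_f (h : IsAdaptedOn g U l L e f) (hg : IsLorentzOn g U) (hx : x ∈ U) (i : Fin 4) :
    ip g x (nabla1 g f x i) (f x) = 0 := by
  have := hg.ip_nabla1_add hx h.smooth_f h.smooth_f (c := 1)
    (fun y hy => (h.frame y hy).choose_spec.ff) i
  linarith

end IsAdaptedOn

lemma sum_raise_nabla2_wedge (hg : IsLorentzOn g U) (hx : x ∈ U) {u v : Pt → T1 ℝ}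
    (hu : ∀ a, ContDiffOn ℝ ∞ (fun x => u x a) U) (hv : ∀ a, ContDiffOn ℝ ∞ (fun x => v x a) U)
    {F : Pt → T2 ℝ} (hF : ∀ y ∈ U, F y = wedge (u y) (v y)) (w : T1 ℝ) :
    (fun a b => ∑ i, raise g x w i * nabla2 g F x i a b)
      = wedge (nablaDir g u x w) (v x) + wedge (u x) (nablaDir g v x w) := by
  funext a b
  simp only [hg.nabla2_wedge hx hu hv hF, Pi.add_apply, wedge, nablaDir, Finset.sum_mul,
    Finset.mul_sum, ← Finset.sum_sub_distrib, ← Finset.sum_add_distrib]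
  exact Finset.sum_congr rfl fun i _ => by ring

lemma nabla2_const_mul (hg : IsLorentzOn g U) (hx : x ∈ U) {F : Pt → T2 ℝ}
    (hF : ∀ a b, ContDiffOn ℝ ∞ (fun x => F x a b) U) (c : ℝ) (i a b : Fin 4) :
    nabla2 g (fun y a b => c * F y a b) x i a b = c * nabla2 g F x i a b := by
  simp only [nabla2]
  rw [pd_const_mul (differentiableAt_of_contDiffOn hg.isOpen hx (hF a b)), mul_sub, Finset.mul_sum]
  congr 1
  exact Finset.sum_congr rfl fun k _ => by ring

lemma nablaBivector_eq (hg : IsLorentzOn g U) (hx : x ∈ U)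
    (hL : ∀ a b, ContDiffOn ℝ ∞ (fun x => L x a b) U) (u : T1 ℝ) :
    nablaBivector g L x u = fun a b => (1 / Real.sqrt 2 : ℂ) *
      (((∑ i, raise g x u i * nabla2 g L x i a b : ℝ) : ℂ)
        - Complex.I * ((∑ i, raise g x u i * nabla2 g (starL g L) x i a b : ℝ) : ℂ)) := by
  have hc : (1 / Real.sqrt 2 : ℂ) = ((1 / Real.sqrt 2 : ℝ) : ℂ) := by push_cast; rfl
  have hre : (fun y a b => (bivector g L y a b).re)
      = fun y a b => (1 / Real.sqrt 2) * L y a b := by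
    funext y a b
    rw [bivector, hc]
    generalize 1 / Real.sqrt 2 = c
    simp
  have him : (fun y a b => (bivector g L y a b).im)
      = fun y a b => (-(1 / Real.sqrt 2)) * starL g L y a b := by
    funext y a b
    rw [bivector, hc]
    generalize 1 / Real.sqrt 2 = c
    simp
  funext a b
  simp only [nablaBivector, nabla2C]
  rw [hre, him]
  simp only [nabla2_const_mul hg hx hL, nabla2_const_mul (F := starL g L) hg hx
    (hg.contDiffOn_star hL)]
  push_cast
  rw [Finset.mul_sum, ← Finset.sum_sub_distrib, Finset.mul_sum]
  exact Finset.sum_congr rfl fun i _ => by ring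

/-- The square of the derivative of the fundamental bivector in the direction `u` measures the
components of `∇_u l` transverse to `l`. -/
lemma IsAdaptedOn.ip2_nablaBivector (h : IsAdaptedOn g U l L e f) (hg : IsLorentzOn g U)
    (hx : x ∈ U) (hL : ∀ a b, ContDiffOn ℝ ∞ (fun x => L x a b) U) (u : T1 ℝ) :
    ip2 g x (nablaBivector g L x u) (nablaBivector g L x u)
      = ((ip g x (nablaDir g l x u) (f x) : ℂ)
        + Complex.I * (ip g x (nablaDir g l x u) (e x) : ℂ)) ^ 2 := by
  have hl := hg.lorentz x hx
  obtain ⟨k, hF⟩ := h.frame x hx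
  have fe := (hl.ip_comm (f x) (e x)).trans hF.ef
  set n := nablaDir g l x u
  have nl : ip g x n (l x) = 0 := by simp [n, ip_nablaDir, h.ip_nabla1_l hg hx]
  have el : ip g x (nablaDir g e x u) (l x) = -ip g x n (e x) := by
    simp [n, ip_nablaDir, h.ip_nabla1_e_l hg hx]
  have fl : ip g x (nablaDir g f x u) (l x) = -ip g x n (f x) := by
    simp [n, ip_nablaDir, h.ip_nabla1_f_l hg hx]
  have ee : ip g x (nablaDir g e x u) (e x) = 0 := by
    simp [ip_nablaDir, h.ip_nabla1_e hg hx]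
  have ff : ip g x (nablaDir g f x u) (f x) = 0 := by
    simp [ip_nablaDir, h.ip_nabla1_f hg hx]
  have nn : ip g x n n = ip g x n (e x) ^ 2 + ip g x n (f x) ^ 2 := by
    have h1 : n = (-ip g x n k) • l x + (ip g x n (e x) • e x + ip g x n (f x) • f x) := by
      funext b
      have := hF.expand hl n b
      rw [nl] at this
      simp only [Pi.add_apply, Pi.smul_apply, smul_eq_mul]
      linear_combination this
    calc ip g x n n
        = ip g x n ((-ip g x n k) • l x + (ip g x n (e x) • e x + ip g x n (f x) • f x)) := by
          rw [← h1]
      _ = _ := by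
          simp only [ip_add_right, ip_smul_right, nl]
          ring
  have hadd : ∀ F F' H H' : T2 ℝ, ip2 g x (F + F') (H + H')
      = ip2 g x F H + ip2 g x F H' + ip2 g x F' H + ip2 g x F' H' := by
    intro F F' H H'
    rw [ip2_add_left, hl.ip2_comm F, hl.ip2_comm F', ip2_add_left, ip2_add_left,
      hl.ip2_comm H, hl.ip2_comm H', hl.ip2_comm H, hl.ip2_comm H']
    ring
  have hc2 : (1 / Real.sqrt 2 : ℂ) ^ 2 = 1 / 2 := by
    rw [div_pow, one_pow, ← Complex.ofReal_pow, Real.sq_sqrt (by norm_num)]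
    norm_num
  rw [nablaBivector_eq hg hx hL, hl.ip2_complex, hc2,
    sum_raise_nabla2_wedge hg hx h.smooth_l h.smooth_e h.L_eq,
    sum_raise_nabla2_wedge hg hx h.smooth_l h.smooth_f h.star_eq]
  simp only [hadd, hl.ip2_wedge]
  rw [hl.ip_comm (l x) n, hl.ip_comm (e x) n, hl.ip_comm (f x) n,
    hl.ip_comm (e x) (nablaDir g e x u), hl.ip_comm (f x) (nablaDir g f x u),
    hl.ip_comm (l x) (nablaDir g e x u), hl.ip_comm (l x) (nablaDir g f x u),
    hl.ip_comm (e x) (l x), hl.ip_comm (f x) (l x)]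
  rw [nn, nl, el, fl, ee, ff, hF.ll, hF.le, hF.lf, hF.ee, hF.ef, hF.ff]
  push_cast
  linear_combination (-(ip g x n (e x) : ℂ) ^ 2) * Complex.I_sq

/-- The invariant vector `a` has components `(∇_i l, e)`. -/
lemma IsAdaptedOn.vecA_eq (h : IsAdaptedOn g U l L e f) (hg : IsLorentzOn g U) (hx : x ∈ U)
    {t : Pt → T1 ℝ} (ht : pair (l x) (t x) ≠ 0) (i : Fin 4) :
    vecA g l L t x i = ip g x (nabla1 g l x i) (e x) := by
  obtain ⟨k, hF⟩ := h.frame x hx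
  have el := ((hg.lorentz x hx).ip_comm (e x) (l x)).trans hF.le
  have h1 : ∑ p, ∑ q, nabla2 g L x i p q * raise g x (l x) q * t x p
      = -(ip g x (nabla1 g l x i) (e x) * pair (l x) (t x)) := by
    rw [hg.nabla2_wedge hx h.smooth_l h.smooth_e h.L_eq]
    calc _ = pair (nabla1 g l x i) (t x) * ip g x (e x) (l x)
          - pair (e x) (t x) * ip g x (nabla1 g l x i) (l x)
          + pair (l x) (t x) * ip g x (nabla1 g e x i) (l x)
          - pair (nabla1 g e x i) (t x) * ip g x (l x) (l x) := by
          simp only [ip_eq_pair_raise, pair, wedge, Pi.add_apply, Fin.sum_univ_four]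
          ring
      _ = _ := by rw [el, h.ip_nabla1_l hg hx, h.ip_nabla1_e_l hg hx, hF.ll]; ring
  rw [vecA, h1]
  field_simp

/-- The invariant vector `a*` has components `-(∇_i l, f)`. -/
lemma IsAdaptedOn.vecAstar_eq (h : IsAdaptedOn g U l L e f) (hg : IsLorentzOn g U) (hx : x ∈ U)
    {t : Pt → T1 ℝ} (ht : pair (l x) (t x) ≠ 0) (i : Fin 4) :
    vecAstar g l L t x i = -ip g x (nabla1 g l x i) (f x) := by
  obtain ⟨k, hF⟩ := h.frame x hx
  have fl := ((hg.lorentz x hx).ip_comm (f x) (l x)).trans hF.lf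
  have h1 : ∑ p, ∑ q, nabla2 g (starL g L) x i p q * raise g x (l x) q * t x p
      = -(ip g x (nabla1 g l x i) (f x) * pair (l x) (t x)) := by
    rw [hg.nabla2_wedge hx h.smooth_l h.smooth_f h.star_eq]
    calc _ = pair (nabla1 g l x i) (t x) * ip g x (f x) (l x)
          - pair (f x) (t x) * ip g x (nabla1 g l x i) (l x)
          + pair (l x) (t x) * ip g x (nabla1 g f x i) (l x)
          - pair (nabla1 g f x i) (t x) * ip g x (l x) (l x) := by
          simp only [ip_eq_pair_raise, pair, wedge, Pi.add_apply, Fin.sum_univ_four]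
          ring
      _ = _ := by rw [fl, h.ip_nabla1_l hg hx, h.ip_nabla1_f_l hg hx, hF.ll]; ring
  rw [vecAstar, h1]
  field_simp

lemma eq_zero_of_add_I_mul_sq {p q : ℝ} (h : ((p : ℂ) + Complex.I * (q : ℂ)) ^ 2 = 0) :
    p = 0 ∧ q = 0 := by
  have h1 := pow_eq_zero_iff (two_ne_zero) |>.mp h
  have hre := congrArg Complex.re h1
  have him := congrArg Complex.im h1
  simp at hre him
  exact ⟨hre, him⟩

/-- The vanishing of `φ₁` and `φ₂` means that `∇_u l` is proportional to `l` for `u` orthogonal to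
`l`, that is, `∇l = w ⊗ l + l ⊗ s`: in terms of spin coefficients, `κ = σ = ρ = 0`. -/
lemma IsAdaptedOn.exists_nabla1_eq (h : IsAdaptedOn g U l L e f) (hg : IsLorentzOn g U)
    (hx : x ∈ U) (hL : ∀ a b, ContDiffOn ℝ ∞ (fun x => L x a b) U)
    {t : Pt → T1 ℝ} (ht : pair (l x) (t x) ≠ 0)
    (h1 : phi1 g l L x = 0) (h2 : phi2 g l L t x = 0) :
    ∃ w s : T1 ℝ, ∀ i j, nabla1 g l x i j = w i * l x j + l x i * s j := by
  have hl := hg.lorentz x hx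
  obtain ⟨k, hF⟩ := h.frame x hx
  have el := (hl.ip_comm (e x) (l x)).trans hF.le
  have fl := (hl.ip_comm (f x) (l x)).trans hF.lf
  have fe := (hl.ip_comm (f x) (e x)).trans hF.ef
  set a := vecA g l L t x with ha
  set a' := vecAstar g l L t x with ha'
  have hne : ∀ u, ip g x (nablaDir g l x u) (e x) = ip g x a u := by
    intro u
    rw [ip_nablaDir, ip_eq_pair_raise, pair]
    refine Finset.sum_congr rfl fun i _ => ?_
    rw [ha, h.vecA_eq hg hx ht]
    ring
  have hnf : ∀ u, ip g x (nablaDir g l x u) (f x) = -ip g x a' u := by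
    intro u
    rw [ip_nablaDir, ip_eq_pair_raise, pair, ← Finset.sum_neg_distrib]
    refine Finset.sum_congr rfl fun i _ => ?_
    rw [ha', h.vecAstar_eq hg hx ht]
    ring
  have hphi : ∀ u, ip2 g x (nablaBivector g L x u) (nablaBivector g L x u) = 0 →
      ip g x a u = 0 ∧ ip g x a' u = 0 := by
    intro u hu
    rw [h.ip2_nablaBivector hg hx hL] at hu
    obtain ⟨p, q⟩ := eq_zero_of_add_I_mul_sq hu
    rw [hnf] at p
    rw [hne] at q
    exact ⟨q, by linarith⟩
  obtain ⟨al, al'⟩ := hphi (l x) h1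
  have h2' : ip2 g x (F2 g l L t x) (F2 g l L t x) = 0
      ∧ ip2 g x (F2star g l L t x) (F2star g l L t x) = 0 := by
    unfold phi2 at h2
    constructor <;> rw [← norm_eq_zero] <;>
    linarith [norm_nonneg (ip2 g x (F2 g l L t x) (F2 g l L t x)),
      norm_nonneg (ip2 g x (F2star g l L t x) (F2star g l L t x))]
  obtain ⟨aa, -⟩ := hphi a h2'.1
  obtain ⟨-, aa'⟩ := hphi a' h2'.2
  -- A vector orthogonal to `l` and null is proportional to `l`.
  have hnull : ∀ v, ip g x v (l x) = 0 → ip g x v v = 0 →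
      ip g x v (e x) = 0 ∧ ip g x v (f x) = 0 := by
    intro v v1 v2
    have h3 : v = (-ip g x v k) • l x + (ip g x v (e x) • e x + ip g x v (f x) • f x) := by
      funext b
      have := hF.expand hl v b
      rw [v1] at this
      simp only [Pi.add_apply, Pi.smul_apply, smul_eq_mul]
      linear_combination this
    have h4 : ip g x v v = ip g x v (e x) ^ 2 + ip g x v (f x) ^ 2 := by
      calc ip g x v v
          = ip g x v ((-ip g x v k) • l x + (ip g x v (e x) • e x + ip g x v (f x) • f x)) := by
            rw [← h3]
        _ = _ := by
            simp only [ip_add_right, ip_smul_right, v1]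
            ring
    rw [v2] at h4
    constructor <;> refine pow_eq_zero_iff (two_ne_zero) |>.mp ?_ <;>
      linarith [sq_nonneg (ip g x v (e x)), sq_nonneg (ip g x v (f x))]
  obtain ⟨ae, af⟩ := hnull a al aa
  obtain ⟨ae', af'⟩ := hnull a' al' aa'
  -- Hence `∇_u l` is proportional to `l` for `u = l, e, f`.
  have hdir : ∀ u, ip g x a u = 0 → ip g x a' u = 0 → ∀ j,
      nablaDir g l x u j = -ip g x (nablaDir g l x u) k * l x j := by
    intro u u1 u2 j
    have h3 := hF.expand hl (nablaDir g l x u) j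
    have h4 : ip g x (nablaDir g l x u) (l x) = 0 := by
      simp [ip_nablaDir, h.ip_nabla1_l hg hx]
    rw [hne, hnf, u1, u2, h4] at h3
    rw [h3]
    ring
  have hl1 := hdir (l x) al al'
  have he1 := hdir (e x) ae ae'
  have hf1 := hdir (f x) af af'
  refine ⟨fun i => ip g x (nablaDir g l x (l x)) k * k i - ip g x (nablaDir g l x (e x)) k * e x i
    - ip g x (nablaDir g l x (f x)) k * f x i, fun j => -nablaDir g l x k j, fun i j => ?_⟩
  have hcol : ∀ u, ip g x (fun i => nabla1 g l x i j) u = nablaDir g l x u j := by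
    intro u
    rw [ip_eq_pair_raise, pair, nablaDir]
    exact Finset.sum_congr rfl fun i _ => by ring
  have h3 := hF.expand hl (fun i => nabla1 g l x i j) i
  simp only [hcol] at h3
  rw [h3, hl1, he1, hf1]
  ring

/-- In the setting of `IsAdaptedOn.exists_nabla1_eq` the factors can be chosen smooth. -/
lemma IsAdaptedOn.exists_smooth_nabla1_eq (h : IsAdaptedOn g U l L e f) (hg : IsLorentzOn g U)
    (hL : ∀ a b, ContDiffOn ℝ ∞ (fun x => L x a b) U)
    {t : Pt → T1 ℝ} (ht : ∀ a, ContDiffOn ℝ ∞ (fun x => t x a) U)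
    (hp : ∀ y ∈ U, pair (l y) (t y) ≠ 0)
    (h1 : ∀ y ∈ U, phi1 g l L y = 0) (h2 : ∀ y ∈ U, phi2 g l L t y = 0) :
    ∃ w s : Pt → T1 ℝ, (∀ a, ContDiffOn ℝ ∞ (fun x => w x a) U) ∧
      (∀ a, ContDiffOn ℝ ∞ (fun x => s x a) U) ∧
      ∀ y ∈ U, ∀ i j, nabla1 g l y i j = w y i * l y j + l y i * s y j := by
  have hN := hg.contDiffOn_nabla1 h.smooth_l
  have hpair := contDiffOn_pair h.smooth_l ht
  -- `w` and `s` are recovered, up to the gauge `w + h l, s - h l`, by inserting `t` in `∇l`.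
  refine ⟨fun y i => (∑ j, nabla1 g l y i j * t y j) / pair (l y) (t y),
    fun y j => (∑ i, nabla1 g l y i j * t y i) / pair (l y) (t y)
      - (∑ i, ∑ j, nabla1 g l y i j * t y i * t y j) / pair (l y) (t y) ^ 2 * l y j, ?_, ?_, ?_⟩
  · exact fun i => (ContDiffOn.sum fun j _ => (hN i j).mul (ht j)).div hpair hp
  · exact fun j => ((ContDiffOn.sum fun i _ => (hN i j).mul (ht i)).div hpair hp).sub
      (((ContDiffOn.sum fun i _ => ContDiffOn.sum fun j _ => ((hN i j).mul (ht i)).mul (ht j)).div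
        (hpair.pow 2) fun y hy => pow_ne_zero 2 (hp y hy)).mul (h.smooth_l j))
  · intro y hy i j
    obtain ⟨w, s, hws⟩ := h.exists_nabla1_eq hg hy hL (hp y hy) (h1 y hy) (h2 y hy)
    have hpy := hp y hy
    have e1 : ∑ j, nabla1 g l y i j * t y j = w i * pair (l y) (t y) + l y i * pair s (t y) := by
      simp only [hws, pair, Fin.sum_univ_four]
      ring
    have e2 : ∑ i, nabla1 g l y i j * t y i = pair w (t y) * l y j + pair (l y) (t y) * s j := by
      simp only [hws, pair, Fin.sum_univ_four]
      ring
    have e3 : ∑ i, ∑ j, nabla1 g l y i j * t y i * t y j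
        = pair (l y) (t y) * (pair w (t y) + pair s (t y)) := by
      simp only [hws, pair, Fin.sum_univ_four]
      ring
    beta_reduce
    rw [e1, e2, e3, hws]
    field_simp
    ring

end Adapted

/-! ### Spacetimes -/

lemma ricci_eq_tensorQ {g : Metric} {x : Pt} (b d : Fin 4) :
    ricci g x b d = 2 * tensorQ g x b d + scalarCurv g x / 6 * g x b d := by
  unfold tensorQ
  ring

/-- In the family `Ĉ6` the fundamental vector is an eigenvector of `Q` whose eigenvalue, like the
corresponding one of the Ricci tensor, is at least double. -/
lemma InFamilyC6On.eigenvector {g : Metric} {D : Set Pt} (hg : IsLorentzOn g D)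
    (h : InFamilyC6On g D) {x : Pt} (hx : x ∈ D) {l : T1 ℝ} {L : T2 ℝ}
    (hl : IsFundamentalAt g x l L) :
    ∃ lam : ℝ, (∀ a, ∑ b, tensorQ g x a b * raise g x l b = lam * l a) ∧
      2 ≤ (mixed g x (tensorQ g x)).charpoly.rootMultiplicity lam ∧
      2 ≤ (mixed g x (ricci g x)).charpoly.rootMultiplicity (2 * lam + scalarCurv g x / 6) := by
  obtain ⟨hN, hloc⟩ := h
  obtain ⟨U, l₁, L₁, t, hU, hxU, hUD, sl, sL, st, hphi⟩ := hloc x hx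
  have hW : ∀ y ∈ U, weyl g y ≠ 0 := fun y hy => (hN y (hUD hy)).1
  have hgU : IsLorentzOn g U :=
    ⟨hU, hg.symm, fun a b => (hg.smooth a b).mono hUD, fun y hy => hg.lorentz y (hUD hy)⟩
  have hLx := hg.lorentz x hx
  obtain ⟨hp, e, f, had⟩ := hgU.exists_isAdaptedOn hW sl sL st (fun y hy => (hphi y hy).1)
    fun y hy => (hphi y hy).2.1
  obtain ⟨w, s, sw, ss, hws⟩ := had.exists_smooth_nabla1_eq hgU sL st hp
    (fun y hy => (hphi y hy).2.2.1) fun y hy => (hphi y hy).2.2.2.1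
  obtain ⟨A, X, Y, hR⟩ := hgU.riemannUp_of_nabla1 hxU sl sw ss hws
  have hfund := (hphi x hxU).1
  obtain ⟨lam, hlam⟩ := hfund.tensorQ_eigenvector hgU hxU (hW x hxU) hR
  obtain ⟨c, rfl⟩ := hfund.parallel hLx (hW x hxU) hl
  have hc : ∀ a, ∑ b, tensorQ g x a b * raise g x (c • l₁ x) b = lam * (c • l₁ x) a := by
    intro a
    have h1 : ∀ b, raise g x (c • l₁ x) b = c * raise g x (l₁ x) b := fun b => by
      simp only [raise, Pi.smul_apply, smul_eq_mul, Finset.mul_sum]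
      exact Finset.sum_congr rfl fun _ _ => by ring
    simp only [h1, Pi.smul_apply, smul_eq_mul]
    rw [mul_left_comm, ← hlam, Finset.mul_sum]
    exact Finset.sum_congr rfl fun _ _ => by ring
  have hsymm := hfund.tensorQ_symm hgU hxU (hW x hxU)
  obtain ⟨k, hF⟩ := had.frame x hxU
  refine ⟨lam, hc, hF.two_le_rootMultiplicity hLx hsymm hlam,
    hF.two_le_rootMultiplicity hLx (fun a b => ?_) fun a => ?_⟩
  · rw [ricci_eq_tensorQ, ricci_eq_tensorQ, hsymm a b, hg.symm x a b]
  · simp only [ricci_eq_tensorQ]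
    calc _ = 2 * (∑ b, tensorQ g x a b * raise g x (l₁ x) b)
          + scalarCurv g x / 6 * ∑ b, g x a b * raise g x (l₁ x) b := by
          simp only [Finset.mul_sum, ← Finset.sum_add_distrib]
          exact Finset.sum_congr rfl fun _ _ => by ring
      _ = _ := by rw [hlam, hLx.sum_g_mul_raise]; ring

section Chart

/-- The Gram matrix of the images of vectors `v j` in terms of that of the coordinate vectors. -/
lemma transpose_mul_gram_mul {V : Type*} [AddCommGroup V] [Module ℝ V]
    (T : LinearMap.BilinForm ℝ V) (φ : Pt →ₗ[ℝ] V) (v : Fin 4 → Pt) :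
    (Matrix.of fun i j => v j i).transpose
        * Matrix.of (fun i j => T (φ (EuclideanSpace.single i 1)) (φ (EuclideanSpace.single j 1)))
        * Matrix.of (fun i j => v j i)
      = Matrix.of fun i j => T (φ (v i)) (φ (v j)) := by
  have hv : ∀ j, φ (v j) = ∑ i, v j i • φ (EuclideanSpace.single i 1) := by
    intro j
    conv_lhs => rw [← (EuclideanSpace.basisFun (Fin 4) ℝ).sum_repr (v j)]
    simp
  ext i j
  simp only [Matrix.mul_apply, Matrix.transpose_apply, Matrix.of_apply, hv i, hv j, map_sum,
    map_smul, LinearMap.sum_apply, LinearMap.smul_apply, smul_eq_mul, Finset.sum_mul,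
    Finset.mul_sum]
  exact Finset.sum_congr rfl fun p _ => Finset.sum_congr rfl fun q _ => by ring

variable {M : Type*} [TopologicalSpace M] [ChartedSpace Pt M] [IsManifold (𝓡 4) ∞ M]

/-- The components of a Lorentz metric in a chart have Lorentzian signature, since the differential
of the chart is an isomorphism. -/
lemma LorentzMetric.isLorentzOn (g : LorentzMetric M) {e : OpenPartialHomeomorph M Pt}
    (he : e ∈ atlas Pt M) : IsLorentzOn (g.inChart e) e.target := by
  have hsymm : ∀ x a b, g.inChart e x a b = g.inChart e x b a := fun x a b => g.symm _ _ _
  refine ⟨e.open_target, hsymm, g.smooth e he, fun x hx => ⟨?_, ?_⟩⟩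
  · ext a b
    exact hsymm x b a
  have : IsManifold (𝓡 4) 1 M := IsManifold.of_le (n := ∞) (by simp)
  have hmd := (mdifferentiable_of_mem_atlas (I := 𝓡 4) he).symm
  obtain ⟨b, hb⟩ := g.signature (e.symm x)
  have hbij := hmd.mfderiv_bijective (x := x) hx
  obtain ⟨v, hv⟩ : ∃ v : Fin 4 → Pt, ∀ i, mfderiv (𝓡 4) (𝓡 4) e.symm x (v i) = b i :=
    ⟨fun i => (hbij.2 (b i)).choose, fun i => (hbij.2 (b i)).choose_spec⟩
  refine ⟨Matrix.of fun i j => v j i, ?_⟩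
  have hgram := transpose_mul_gram_mul (g.val (e.symm x))
    (mfderiv (𝓡 4) (𝓡 4) e.symm x).toLinearMap v
  refine hgram.trans ?_
  ext i j
  change g.val (e.symm x) (mfderiv (𝓡 4) (𝓡 4) e.symm x (v i))
    (mfderiv (𝓡 4) (𝓡 4) e.symm x (v j)) = _
  rw [hv, hv, hb, Matrix.diagonal_apply]
  fin_cases i <;> simp

end Chart

end TypeN

end

theorem mainTheorem8 {M : Type*} [TopologicalSpace M] [ChartedSpace TypeN.Pt M]
    [IsManifold (𝓡 4) ∞ M] (g : TypeN.LorentzMetric M) (hg : g.InFamilyC6) :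
    ∀ e ∈ atlas TypeN.Pt M, ∀ x ∈ e.target, ∀ (l : TypeN.T1 ℝ) (L : TypeN.T2 ℝ),
      TypeN.IsFundamentalAt (g.inChart e) x l L →
      ∃ lam : ℝ,
        (∀ a, ∑ b, TypeN.tensorQ (g.inChart e) x a b * TypeN.raise (g.inChart e) x l b
          = lam * l a) ∧
        2 ≤ (TypeN.mixed (g.inChart e) x
          (TypeN.tensorQ (g.inChart e) x)).charpoly.rootMultiplicity lam ∧
        2 ≤ (TypeN.mixed (g.inChart e) x
          (TypeN.ricci (g.inChart e) x)).charpoly.rootMultiplicity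
            (2 * lam + TypeN.scalarCurv (g.inChart e) x / 6) := by
  intro e he x hx l L hl
  exact (hg e he).eigenvector (g.isLorentzOn he) hx hl
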